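/- **Setting.** A sequential object $X$ is given by states $Q$, an initial state $q_0$, operations, outputs, and a specification $\sigma(o,q)=(r,q')$. There are $n$ asynchronous processes that may crash; they communicate through atomic base objects. A run is a finite or infinite interleaving of invocations, steps (one base-object access each) and responses; each operation is invoked at most once in a run, and a process runs one operation at a time. A run induces a history $H$ (its invocations and responses of operations of $X$). For orderings $s,s'$ of the same set of operations, $s\simeq s'$ means that from $q_0$ they lead to the same state and give each operation the same output. An operation $op$ *commutes in* $l$ *with* a set $S$ if $l\cdot s\cdot op\simeq l\cdot op\cdot s$ for every ordering $s$ of $S$. A *linearization* of a history $H$ is a legal sequential history that preserves the precedence relation of $H$ and is equivalent (process by process) to a completion of $H$. A *system state during $op$ in $H$* is a pair $(l,O)$ for which there are a prefix $H'$ of $H$ containing the invocation but not the response of $op$, and a linearization $L$ of $H$, such that $l$ is a finite prefix of $L$, $l$ is a linearization of $H'$, $op\notin l$, and $O$ is the set of all $op'\neq op$ invoked in $H'$ with $op'\notin l$. An implementation of $X$ is *dynamically concurrent* if for every history $H$ induced by a run and every $op\in H$: if the process of $op$ uses a strong synchronization primitive while executing $op$, then there are a system state $(l,O)$ during $op$ in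 $H$ and a subset $O'\subseteq O$ with which $op$ does not commute in $l$. **The algorithm.** The shared objects are: an Announce-Book-Commit graph $G=(A,B,C)$, where $A$ is a set of operations, $B$ assigns integers to operations (the minimum over repeated additions), and $C$ is a directed graph on operations, given by a set of predecessors of each operation (the union over repeated additions), implemented over an atomic snapshot object to which each process writes everything it has added; an atomic snapshot object $K$ with entries $K[i]$, initially $0$; and consensus objects $\mathrm{CONS}_k$, $k\ge1$, the only strong primitives. $\mathrm{linearize}(C)$ is a fixed procedure that returns a topological ordering of every acyclic $C$. Process $p_i$ executes an operation $op$ by $\mathrm{publish}(op)$: 1. $\mathrm{add}_A(op)$; read $(A,B,C)$ (first read); $\mathrm{add}_B(op,|A|)$; read $(A,B,C)$ (second read); $l\gets\mathrm{linearize}(C)$. 2. If $op\in\mathrm{vertices}(C)$, return the result of $op$ in $l$. Otherwise, if $op$ commutes in $l$ with every subset of $A\setminus\mathrm{vertices}(C)\setminus\{op\}$, then $\mathrm{add}_C(op,\mathrm{vertices}(C))$ and return the result of $op$ in $l\cdot op$. 3. Otherwise $k\gets\max_j K[j]$ and repeat: $k\gets k+1$; read $(A,B,C)$; if $op\in\mathrm{vertices}(C)$,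 return the result of $op$ in $\mathrm{linearize}(C)$; choose $\tilde{op}$ with minimal $B$-value among the operations in $B$ that are not in $\mathrm{vertices}(C)$; $\hat{op}\gets\mathrm{CONS}_k.\mathrm{propose}(\tilde{op})$; read $(A,B,C)$; if $\hat{op}\notin\mathrm{vertices}(C)$, then $\mathrm{add}_C(\hat{op},\mathrm{vertices}(C))$; write $k$ to $K[i]$. **Statement.** For every sequential object $X$, every $n$, every topological sorting procedure $\mathrm{linearize}$ and every rule for choosing $\tilde{op}$ among the minimal operations, this algorithm is a dynamically concurrent implementation of $X$. More precisely, let $H$ be the history induced by a run, let $op\in H$, and suppose that its process uses consensus while executing $\mathrm{publish}(op)$. Let $(A,B,C)$ be the value returned by the second read of $\mathrm{publish}(op)$ and $l=\mathrm{linearize}(C)$. Then there is a set $O\supseteq A\setminus\mathrm{vertices}(C)\setminus\{op\}$ such that $(l,O)$ is a system state during $op$ in $H$, and there is a subset $O'\subseteq A\setminus\mathrm{vertices}(C)\setminus\{op\}$ with which $op$ does not commute in $l$. -/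

import Mathlib

/-! ### Sequential objects, equivalence and commutativity of operations -/

/-- A sequential object with states `Q`, operations `O`, outputs `R`, an initial state and a
sequential specification `σ`. -/
structure SeqObject (Q O R : Type*) where
  init : Q
  σ : O → Q → R × Q

namespace SeqObject

variable {Q O R : Type*}

/-- The state reached from the initial state by applying the sequence `s`. -/
def stateAfter (X : SeqObject Q O R) (s : List O) : Q :=
  s.foldl (fun q o => (X.σ o q).2) X.init

/-- The output of `op` in the sequence `s` (whose elements are distinct): what `op` returns after
the operations that stand before it in `s`. -/
def result [DecidableEq O] (X : SeqObject Q O R) (s : List O) (op : O) : R :=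
  (X.σ op (X.stateAfter (s.takeWhile (fun o => decide (o ≠ op))))).1

/-- `s ≃ s'`: orderings of the same set of operations that lead to the same state and give every
operation the same output. -/
def OrdEquiv [DecidableEq O] (X : SeqObject Q O R) (s s' : List O) : Prop :=
  s.Perm s' ∧ X.stateAfter s = X.stateAfter s' ∧ ∀ o ∈ s, X.result s o = X.result s' o

/-- `op` commutes in `l` with the sequence `s`. -/
def CommutesSeq [DecidableEq O] (X : SeqObject Q O R) (op : O) (l s : List O) : Prop :=
  X.OrdEquiv (l ++ s ++ [op]) (l ++ [op] ++ s)

/-- `op` commutes in `l` with the set `S`: it commutes in `l` with every ordering of `S`. -/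
def CommutesSet [DecidableEq O] (X : SeqObject Q O R) (op : O) (l : List O) (S : Set O) : Prop :=
  ∀ s : List O, s.Nodup → (∀ o, o ∈ s ↔ o ∈ S) → X.CommutesSeq op l s

end SeqObject

/-! ### Finite or infinite sequences (`Stream'.Seq`) -/

open Classical in
/-- The subsequence of the defined values of `f` along the finite or infinite sequence `s`:
its `k`-th entry is the value at the `k`-th position at which `f` is defined. -/
noncomputable def seqFilterMap {α β : Type*} (f : α → Option β) (s : Stream'.Seq α) :
    Stream'.Seq β :=
  ⟨fun k =>
      if ∃ i, ((s.get? i).bind f).isSome ∧ Nat.count (fun j => ((s.get? j).bind f).isSome) i = k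
      then (s.get? (Nat.nth (fun j => ((s.get? j).bind f).isSome) k)).bind f
      else none, by
    intro k hk
    change ite _ _ _ = _ at hk
    change ite _ _ _ = _
    rw [if_neg]
    rintro ⟨i, hi, hc⟩
    have key : ∀ m, Nat.count (fun j => ((s.get? j).bind f).isSome) m = k + 1 →
        ∃ j, ((s.get? j).bind f).isSome ∧
          Nat.count (fun j => ((s.get? j).bind f).isSome) j = k := by
      intro m
      induction m with
      | zero => intro h; simp at h
      | succ m ih =>
        intro h
        rw [Nat.count_succ] at h
        split_ifs at h with hm
        · exact ⟨m, hm, by omega⟩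
        · exact ih (by omega)
    obtain ⟨j, hj, hjk⟩ := key i hc
    rw [if_pos ⟨j, hj, hjk⟩, ← hjk, Nat.nth_count hj] at hk
    rw [hk] at hj
    simp at hj⟩

/-- `s` is a (finite or infinite) prefix of `t`. -/
def SeqPrefix {α : Type*} (s t : Stream'.Seq α) : Prop :=
  ∀ i a, s.get? i = some a → t.get? i = some a

/-! ### Histories and linearizations -/

/-- Invocations and responses of operations in `O` with outputs in `R` by processes in `P`. -/
inductive HEvent (P O R : Type*) where
  | inv (p : P) (op : O)
  | res (p : P) (op : O) (r : R)

namespace HEvent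

variable {P O R : Type*}

def proc : HEvent P O R → P
  | inv p _ => p
  | res p _ _ => p

def op : HEvent P O R → O
  | inv _ o => o
  | res _ o _ => o

end HEvent

/-- An operation in a sequential history: its process, the operation itself, its response. -/
structure Call (P O R : Type*) where
  proc : P
  op : O
  out : R

namespace Hist

variable {P Q O R : Type*}

def HasInv (H : Stream'.Seq (HEvent P O R)) (op : O) : Prop :=
  ∃ i p, H.get? i = some (.inv p op)

def HasRes (H : Stream'.Seq (HEvent P O R)) (op : O) : Prop :=
  ∃ i p r, H.get? i = some (.res p op r)

/-- Operations are invoked at most once and respond at most once, and every response is preceded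
by its matching invocation. -/
structure IsHistory (H : Stream'.Seq (HEvent P O R)) : Prop where
  inv_unique : ∀ i j p p' op, H.get? i = some (.inv p op) → H.get? j = some (.inv p' op) → i = j
  res_unique : ∀ i j p p' op r r',
    H.get? i = some (.res p op r) → H.get? j = some (.res p' op r') → i = j
  inv_before_res : ∀ j p op r, H.get? j = some (.res p op r) → ∃ i < j, H.get? i = some (.inv p op)

/-- The precedence relation `a <_H b`: the response of `a` precedes the invocation of `b`. -/
def Precedes (H : Stream'.Seq (HEvent P O R)) (a b : O) : Prop :=
  ∃ i j p p' r, i < j ∧ H.get? i = some (.res p a r) ∧ H.get? j = some (.inv p' b)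

open Classical in
/-- `H | p`. -/
noncomputable def restrict (H : Stream'.Seq (HEvent P O R)) (p : P) : Stream'.Seq (HEvent P O R) :=
  seqFilterMap (fun e => if e.proc = p then some e else none) H

/-- Equivalence of histories: `H | p = H' | p` for every process `p`. -/
def Equivalent (H H' : Stream'.Seq (HEvent P O R)) : Prop :=
  ∀ p, restrict H p = restrict H' p

/-- `H'` is a completion of `H`: a history that consists of all complete operations of `H` and of
some incomplete operations of `H`, each with a response, and that preserves the precedence
relation of `H`. -/
structure IsCompletion (H H' : Stream'.Seq (HEvent P O R)) : Prop where
  isHistory : IsHistory H'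
  complete_mem : ∀ e, e ∈ H → HasInv H e.op → HasRes H e.op → e ∈ H'
  inv_mem : ∀ p op, .inv p op ∈ H' → .inv p op ∈ H
  responds : ∀ p op, .inv p op ∈ H' → ∃ r, .res p op r ∈ H'
  precedes : ∀ a b, HasInv H' a → HasInv H' b → Precedes H a b → Precedes H' a b

/-- The history of a sequence of calls: each invocation is directly followed by its response. -/
def ofCalls (S : Stream'.Seq (Call P O R)) : Stream'.Seq (HEvent P O R) :=
  ⟨fun i => (S.get? (i / 2)).map
      (fun c => if i % 2 = 0 then .inv c.proc c.op else .res c.proc c.op c.out), by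
    intro i hi
    change Option.map _ (S.get? (i / 2)) = none at hi
    change Option.map _ (S.get? ((i + 1) / 2)) = none
    rw [Option.map_eq_none_iff] at hi ⊢
    exact S.le_stable (by omega) hi⟩

/-- A sequential history is legal if every response is the one that the specification gives. -/
def Legal (X : SeqObject Q O R) (S : Stream'.Seq (Call P O R)) : Prop :=
  ∀ k c, S.get? k = some c →
    c.out = (X.σ c.op (X.stateAfter ((S.take k).map Call.op))).1

/-- The sequential history `S` is a linearization of `H`. -/
structure IsLinearization (X : SeqObject Q O R) (H : Stream'.Seq (HEvent P O R))
    (S : Stream'.Seq (Call P O R)) : Prop where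
  equivalent : ∃ H', IsCompletion H H' ∧ Equivalent (ofCalls S) H'
  precedes : ∀ a b, HasInv (ofCalls S) a → HasInv (ofCalls S) b →
    Precedes H a b → Precedes (ofCalls S) a b
  legal : Legal X S

/-- `(l, Os)` is a system state during `op` in `H`. -/
def IsSystemState (X : SeqObject Q O R) (H : Stream'.Seq (HEvent P O R)) (op : O)
    (l : List O) (Os : Set O) : Prop :=
  ∃ H' : Stream'.Seq (HEvent P O R), SeqPrefix H' H ∧ HasInv H' op ∧ ¬ HasRes H' op ∧
    (∃ L : Stream'.Seq (Call P O R), IsLinearization X H L ∧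
      ∃ l' : List (Call P O R), l'.map Call.op = l ∧
        SeqPrefix (Stream'.Seq.ofList l') L ∧
        IsLinearization X H' (Stream'.Seq.ofList l') ∧ op ∉ l) ∧
    Os = {op' | HasInv H' op' ∧ op' ∉ l ∧ op' ≠ op}

end Hist

/-! ### Implementations, runs and dynamic concurrency -/

/-- What a process does next: wait for an invocation, access a base object, or respond. -/
inductive NextAction (A R : Type*) where
  | idle
  | access (a : A)
  | ret (r : R)

/-- An implementation of an object with operations `O` and outputs `R` by the processes `P`:
atomic base objects (`Mem`, `apply`) and a deterministic automaton for each process. `Strong`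
singles out the accesses to base objects that are strong synchronization primitives. -/
structure Implementation (P O R : Type*) where
  Mem : Type*
  Access : Type*
  Reply : Type*
  Loc : Type*
  initMem : Mem
  apply : P → Access → Mem → Reply × Mem
  Strong : Access → Prop
  initLoc : P → Loc
  /-- Local computation at the invocation of an operation. -/
  start : P → O → Loc → Loc
  next : P → Loc → NextAction Access R
  /-- Local computation on the reply to a base-object access. -/
  cont : P → Reply → Loc → Loc
  /-- Local computation at the response. -/
  finish : P → Loc → Loc

/-- Events of a run; `step p op a` is the access `a` to a base object by `p` while it executes
`op`. -/
inductive Event (P O R A : Type*) where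
  | inv (p : P) (op : O)
  | step (p : P) (op : O) (a : A)
  | res (p : P) (op : O) (r : R)

/-- The part of a run that belongs to the history of the implemented object. -/
def Event.toHist {P O R A : Type*} : Event P O R A → Option (HEvent P O R)
  | .inv p op => some (.inv p op)
  | .step _ _ _ => none
  | .res p op r => some (.res p op r)

namespace Implementation

variable {P Q O R : Type*}

/-- A global state; `cur p` is the operation that `p` is executing, if any. -/
structure Config (I : Implementation P O R) where
  mem : I.Mem
  loc : P → I.Loc
  cur : P → Option O

def initConfig (I : Implementation P O R) : Config I where
  mem := I.initMem
  loc := I.initLoc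
  cur := fun _ => none

/-- The transition relation between global states. -/
inductive Step [DecidableEq P] (I : Implementation P O R) :
    Config I → Event P O R I.Access → Config I → Prop where
  | inv (c : Config I) (p : P) (op : O) (hc : c.cur p = none) :
      Step I c (.inv p op)
        { c with
          loc := Function.update c.loc p (I.start p op (c.loc p))
          cur := Function.update c.cur p (some op) }
  | step (c : Config I) (p : P) (op : O) (a : I.Access) (hc : c.cur p = some op)
      (ha : I.next p (c.loc p) = .access a) :
      Step I c (.step p op a)
        { c with
          mem := (I.apply p a c.mem).2
          loc := Function.update c.loc p (I.cont p (I.apply p a c.mem).1 (c.loc p)) }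
  | res (c : Config I) (p : P) (op : O) (r : R) (hc : c.cur p = some op)
      (hr : I.next p (c.loc p) = .ret r) :
      Step I c (.res p op r)
        { c with
          loc := Function.update c.loc p (I.finish p (c.loc p))
          cur := Function.update c.cur p none }

/-- A finite or infinite run. Processes may be arbitrarily slow and may crash, so no fairness is
required; each operation is invoked at most once. `config i` is the global state before event `i`
(and irrelevant after the end of a finite run). -/
structure Run [DecidableEq P] (I : Implementation P O R) where
  events : Stream'.Seq (Event P O R I.Access)
  config : ℕ → Config I
  config_zero : config 0 = I.initConfig
  step : ∀ i e, events.get? i = some e → Step I (config i) e (config (i + 1))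
  inv_unique : ∀ i j p p' op,
    events.get? i = some (.inv p op) → events.get? j = some (.inv p' op) → i = j

/-- The history that a run induces. -/
noncomputable def Run.history [DecidableEq P] {I : Implementation P O R} (ρ : Run I) :
    Stream'.Seq (HEvent P O R) :=
  seqFilterMap Event.toHist ρ.events

/-- `p` uses a strong synchronization primitive while executing `op`. -/
def Run.UsesStrong [DecidableEq P] {I : Implementation P O R} (ρ : Run I) (p : P) (op : O) :
    Prop :=
  ∃ i a, ρ.events.get? i = some (.step p op a) ∧ I.Strong a

/-- `I` is a dynamically concurrent implementation of `X`. -/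
def DynamicallyConcurrent [DecidableEq P] [DecidableEq O] (X : SeqObject Q O R)
    (I : Implementation P O R) : Prop :=
  ∀ (ρ : Run I) (p : P) (op : O), .inv p op ∈ ρ.history → ρ.UsesStrong p op →
    ∃ (l : List O) (Os : Set O), Hist.IsSystemState X ρ.history op l Os ∧
      ∃ O' ⊆ Os, ¬ X.CommutesSet op l O'

end Implementation

/-! ### Dependency graphs -/

/-- A graph of operations, encoded by pairs `(op, M)` where `M` is the set of operations with an
edge to `op`. -/
abbrev DepGraph (O : Type*) := Finset (O × Finset O)

namespace DepGraph

variable {O : Type*}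

/-- All operations that appear in either part of a pair. -/
def vertices [DecidableEq O] (C : DepGraph O) : Finset O :=
  C.image Prod.fst ∪ C.biUnion Prod.snd

def Edge (C : DepGraph O) (a b : O) : Prop := ∃ M, (b, M) ∈ C ∧ a ∈ M

def Acyclic (C : DepGraph O) : Prop := ∀ a, ¬ Relation.TransGen C.Edge a a

structure IsTopologicalOrdering [DecidableEq O] (C : DepGraph O) (l : List O) : Prop where
  nodup : l.Nodup
  mem_iff : ∀ o, o ∈ l ↔ o ∈ C.vertices
  edge : ∀ a b, C.Edge a b → l.idxOf a < l.idxOf b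

end DepGraph

/-! ### The Announce-Book-Commit graph over an atomic snapshot object -/

/-- The contents of the snapshot object: components `A[j]`, `B[j]`, `C[j]` of each process. -/
structure ABCSnapshot (n : ℕ) (O : Type*) where
  A : Fin n → Finset O
  B : Fin n → Finset (O × ℕ)
  C : Fin n → DepGraph O

/-- The value of the Announce-Book-Commit graph. -/
structure ABC (O : Type*) where
  A : Finset O
  B : Finset (O × ℕ)
  C : DepGraph O

open Classical in
/-- The value that `read()` computes from a snapshot: unions over all processes, grouped by
operation, with the minimum of the integers in `B` and the union of the sets in `C`. -/
noncomputable def ABCSnapshot.merge {n : ℕ} {O : Type*} [DecidableEq O] (T : ABCSnapshot n O) : ABC O where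
  A := Finset.univ.biUnion T.A
  B := (Finset.univ.biUnion T.B).filter
    (fun x => ∀ y ∈ Finset.univ.biUnion T.B, y.1 = x.1 → x.2 ≤ y.2)
  C := ((Finset.univ.biUnion T.C).image Prod.fst).image
    (fun o => (o, ((Finset.univ.biUnion T.C).filter (fun x => x.1 = o)).biUnion Prod.snd))

/-- `w ∈ argmin B[op']` over the booked and uncommitted operations `op'`. -/
def ABC.IsMinBooked {O : Type*} [DecidableEq O] (v : ABC O) (w : O) : Prop :=
  w ∉ v.C.vertices ∧ ∃ b, (w, b) ∈ v.B ∧ ∀ x ∈ v.B, x.1 ∉ v.C.vertices → b ≤ x.2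

/-! ### The universal construction -/

namespace UC

/-- The shared objects: the snapshot object under the Announce-Book-Commit graph, the snapshot
object `K`, and the consensus objects (`cons k` is the value stored in `CONS_k`, if any). -/
structure Memory (n : ℕ) (O : Type*) where
  S : ABCSnapshot n O
  K : Fin n → ℕ
  cons : ℕ → Option O

inductive Access (O : Type*) where
  | writeA (x : Finset O)
  | writeB (x : Finset (O × ℕ))
  | writeC (x : DepGraph O)
  | snapshotS
  | writeK (k : ℕ)
  | snapshotK
  | propose (k : ℕ) (w : O)

/-- Snapshot objects can be implemented from read-write registers; consensus is strong. -/
def Access.IsStrong {O : Type*} : Access O → Prop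
  | .propose _ _ => True
  | _ => False

inductive Reply (n : ℕ) (O : Type*) where
  | ack
  | snapS (T : ABCSnapshot n O)
  | snapK (L : Fin n → ℕ)
  | decided (w : O)

/-- Atomic semantics of the shared objects; a consensus object stores the first proposal and
returns the stored value to everyone. -/
def applyAccess {n : ℕ} {O : Type*} (p : Fin n) (a : Access O) (m : Memory n O) :
    Reply n O × Memory n O :=
  match a with
  | .writeA x => (.ack, { m with S := { m.S with A := Function.update m.S.A p x } })
  | .writeB x => (.ack, { m with S := { m.S with B := Function.update m.S.B p x } })
  | .writeC x => (.ack, { m with S := { m.S with C := Function.update m.S.C p x } })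
  | .snapshotS => (.snapS m.S, m)
  | .writeK k => (.ack, { m with K := Function.update m.K p k })
  | .snapshotK => (.snapK m.K, m)
  | .propose k w =>
    match m.cons k with
    | some w' => (.decided w', m)
    | none => (.decided w, { m with cons := Function.update m.cons k (some w) })

/-- The program counter, i.e. the next line with a shared access (or the return), together with
the local variables that are still needed. `op` is the argument of `publish`. -/
inductive PC (O R : Type*) where
  | idle
  | addA (op : O)
  | read1 (op : O)
  | addB (op : O) (b : ℕ)
  | read2 (op : O)
  /-- Commit `op` with predecessors `M` on the conflict-free path, then return `r`. -/
  | addC (op : O) (M : Finset O) (r : R)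
  | readK (op : O)
  /-- Iteration `k` of the loop: first read. -/
  | loopRead1 (op : O) (k : ℕ)
  /-- Iteration `k`: propose `w`. -/
  | propose (op : O) (k : ℕ) (w : O)
  /-- Iteration `k`: second read, after the decision `w`. -/
  | loopRead2 (op : O) (k : ℕ) (w : O)
  /-- Iteration `k`: commit the decision `w` with predecessors `M`. -/
  | loopAddC (op : O) (k : ℕ) (w : O) (M : Finset O)
  | writeK (op : O) (k : ℕ)
  | ret (r : R)

/-- Local state of a process: the persistent local variables of the Announce-Book-Commit graph
and the program counter. -/
structure Local (O R : Type*) where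
  RA : Finset O
  RB : Finset (O × ℕ)
  RC : DepGraph O
  pc : PC O R

variable {Q O R : Type*} [DecidableEq O]

def next (L : Local O R) : NextAction (Access O) R :=
  match L.pc with
  | .idle => .idle
  | .addA op => .access (.writeA (insert op L.RA))
  | .read1 _ => .access .snapshotS
  | .addB op b => .access (.writeB (insert (op, b) L.RB))
  | .read2 _ => .access .snapshotS
  | .addC op M _ => .access (.writeC (insert (op, M) L.RC))
  | .readK _ => .access .snapshotK
  | .loopRead1 _ _ => .access .snapshotS
  | .propose _ k w => .access (.propose k w)
  | .loopRead2 _ _ _ => .access .snapshotS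
  | .loopAddC _ _ w M => .access (.writeC (insert (w, M) L.RC))
  | .writeK _ k => .access (.writeK k)
  | .ret r => .ret r

open Classical in
/-- The local computation after the second read: return if `op` is already committed; commit `op`
directly if it commutes with every subset of the announced, uncommitted other operations;
otherwise enter conflict resolution. -/
noncomputable def afterRead2 (X : SeqObject Q O R) (lin : DepGraph O → List O) (op : O)
    (v : ABC O) : PC O R :=
  if op ∈ v.C.vertices then .ret (X.result (lin v.C) op)
  else if ∀ O' ⊆ (v.A \ v.C.vertices) \ {op}, X.CommutesSet op (lin v.C) (O' : Set O) then
    .addC op v.C.vertices (X.result (lin v.C ++ [op]) op)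
  else .readK op

/-- The local computation after a shared access. `lin` is the topological sorting procedure and
`sel p op k v` is the choice that process `p`, executing `op`, makes in iteration `k` of conflict
resolution among the operations of minimal `B`-value, after having read `v`. -/
noncomputable def cont {n : ℕ} (X : SeqObject Q O R) (lin : DepGraph O → List O)
    (sel : Fin n → O → ℕ → ABC O → O) (p : Fin n) (rep : Reply n O) (L : Local O R) :
    Local O R :=
  match L.pc, rep with
  | .addA op, .ack => { L with RA := insert op L.RA, pc := .read1 op }
  | .read1 op, .snapS T => { L with pc := .addB op T.merge.A.card }
  | .addB op b, .ack => { L with RB := insert (op, b) L.RB, pc := .read2 op }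
  | .read2 op, .snapS T => { L with pc := afterRead2 X lin op T.merge }
  | .addC op M r, .ack => { L with RC := insert (op, M) L.RC, pc := .ret r }
  | .readK op, .snapK c => { L with pc := .loopRead1 op (Finset.univ.sup c + 1) }
  | .loopRead1 op k, .snapS T =>
    { L with
      pc := if op ∈ T.merge.C.vertices then .ret (X.result (lin T.merge.C) op)
        else .propose op k (sel p op k T.merge) }
  | .propose op k _, .decided w => { L with pc := .loopRead2 op k w }
  | .loopRead2 op k w, .snapS T =>
    { L with
      pc := if w ∉ T.merge.C.vertices then .loopAddC op k w T.merge.C.vertices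
        else .writeK op k }
  | .loopAddC op k w M, .ack => { L with RC := insert (w, M) L.RC, pc := .writeK op k }
  | .writeK op k, .ack => { L with pc := .loopRead1 op (k + 1) }
  | _, _ => L

/-- The universal construction for the object `X`; an operation `op` of the implemented object is
executed as `publish(op)`. -/
noncomputable def impl (n : ℕ) (X : SeqObject Q O R) (lin : DepGraph O → List O)
    (sel : Fin n → O → ℕ → ABC O → O) : Implementation (Fin n) O R where
  Mem := Memory n O
  Access := Access O
  Reply := Reply n O
  Loc := Local O R
  initMem :=
    { S := { A := fun _ => ∅, B := fun _ => ∅, C := fun _ => ∅ }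
      K := fun _ => 0
      cons := fun _ => none }
  apply := applyAccess
  Strong := Access.IsStrong
  initLoc := fun _ => { RA := ∅, RB := ∅, RC := ∅, pc := .idle }
  start := fun _ op L => { L with pc := .addA op }
  next := fun _ L => next L
  cont := cont X lin sel
  finish := fun _ L => { L with pc := .idle }

/-- In the run `ρ`, the second read in the execution of `publish(op)` by `p`
(the one after `op` has been booked) takes place and returns `v`. -/
def SecondRead {n : ℕ} {X : SeqObject Q O R} {lin : DepGraph O → List O}
    {sel : Fin n → O → ℕ → ABC O → O} (ρ : (impl n X lin sel).Run) (p : Fin n) (op : O)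
    (v : ABC O) : Prop :=
  ∃ (i : ℕ) (m : Memory n O) (L : Local O R),
    ρ.events.get? i = some (.step p op (.snapshotS : Access O)) ∧
    (ρ.config i).mem = m ∧ (ρ.config i).loc p = L ∧ L.pc = .read2 op ∧ v = m.S.merge

end UC

/-! List the operations by the time at which they first appear in the commit graph. At most one
appears per step, so these lists, `commits T`, form a chain of prefixes. The central claim is
`lin_equiv`: at every time `T`, the topological order that `lin` picks for the graph is equivalent
to `commits T`. Hence all outputs agree with the commit order (`res_eq_result`). For a second read
at time `t` of an uncommitted operation, the list `l` chosen by `lin`, followed by all later commits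
in commit order, linearizes the whole history, while its prefix `l` linearizes the history up to `t`
(`isSystemState`). A process proposes to a consensus object only after its commutation test failed
at such a read (`slowRead_of_usesStrong`).

The claim is a confluence statement, `Admissible.ordEquiv`. Call an operation fast if its
conflict-free commit has been written, and slow otherwise; a fast operation may also have been
committed by helpers through consensus. The graph need not order every pair, but it contains the
edges `Req` (`edge_of_req`): slow operations are totally ordered, a fast operation follows all it
saw committed, and an unordered pair has a fast member that saw the other announced and uncommitted.
Two orderings of one set that respect `Req`, and contain what their fast members saw committed, are
equivalent by induction on length. Take the fast operation with the latest decision time `t`. If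
everything was announced by `t`, it commutes to the end of both orderings. Otherwise a slow
operation was announced after `t`, and then the operation committed last is slow and stands last in
both. With no fast operation, both are the commit order.

Two protocol facts support this. `CONS_k` is used only after all earlier consensus decisions are
committed (`Settled`). And an operation announced after the decision of a fast `b` gets a larger
booking number than `b`, so consensus cannot choose it before `b` is committed
(`FastAt.mem_V_of_cons`).

Real time is respected because a response comes after the commit: if `a` precedes `b` in the
history, `a` is committed before `b` is announced, which forces the edge from `a` to `b`
(`req_of_lt`). -/

namespace SeqObject

/-! ### Results in concatenations, and equivalence of orderings as a congruence -/

variable {Q O R : Type*} (X : SeqObject Q O R)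

theorem stateAfter_append (s u : List O) :
    X.stateAfter (s ++ u) = u.foldl (fun q o => (X.σ o q).2) (X.stateAfter s) := by
  simp [stateAfter, List.foldl_append]

theorem stateAfter_append_congr {s s' : List O} (h : X.stateAfter s = X.stateAfter s')
    (u : List O) : X.stateAfter (s ++ u) = X.stateAfter (s' ++ u) := by
  rw [stateAfter_append, stateAfter_append, h]

variable [DecidableEq O]

theorem result_append_of_mem {s : List O} {o : O} (h : o ∈ s) (u : List O) :
    X.result (s ++ u) o = X.result s o := by
  have : (s ++ u).takeWhile (fun a => decide (a ≠ o)) = s.takeWhile (fun a => decide (a ≠ o)) := by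
    induction s with
    | nil => simp at h
    | cons a s ih =>
      by_cases ha : a = o
      · simp [ha]
      · have : o ∈ s := by simpa [Ne.symm ha] using h
        simp only [List.cons_append, List.takeWhile_cons, ih this]
  rw [result, result, this]

theorem takeWhile_ne_append {s : List O} {o : O} (h : o ∉ s) (u : List O) :
    (s ++ u).takeWhile (fun a => decide (a ≠ o)) = s ++ u.takeWhile (fun a => decide (a ≠ o)) := by
  apply List.takeWhile_append_of_pos
  intro a ha
  simp only [decide_eq_true_eq]
  rintro rfl
  exact h ha

theorem result_append_cons_self {s : List O} {o : O} (h : o ∉ s) (u : List O) :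
    X.result (s ++ o :: u) o = (X.σ o (X.stateAfter s)).1 := by
  rw [result, takeWhile_ne_append h]
  simp

namespace OrdEquiv

variable {X}

theorem refl (s : List O) : X.OrdEquiv s s := ⟨List.Perm.refl _, rfl, fun _ _ => rfl⟩

theorem of_eq {s s' : List O} (h : s = s') : X.OrdEquiv s s' := h ▸ refl s

theorem symm {s s' : List O} (h : X.OrdEquiv s s') : X.OrdEquiv s' s :=
  ⟨h.1.symm, h.2.1.symm, fun o ho => (h.2.2 o (h.1.mem_iff.2 ho)).symm⟩

theorem trans {s s' s'' : List O} (h : X.OrdEquiv s s') (h' : X.OrdEquiv s' s'') :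
    X.OrdEquiv s s'' :=
  ⟨h.1.trans h'.1, h.2.1.trans h'.2.1,
    fun o ho => (h.2.2 o ho).trans (h'.2.2 o (h.1.mem_iff.1 ho))⟩

/-- Operations that occur only in `u` depend on what comes before `u` only through the state
reached; this is why equivalence includes the final state. -/
theorem append_right {s s' : List O} (h : X.OrdEquiv s s') (u : List O) :
    X.OrdEquiv (s ++ u) (s' ++ u) := by
  refine ⟨h.1.append_right u, X.stateAfter_append_congr h.2.1 u, fun o ho => ?_⟩
  by_cases hs : o ∈ s
  · rw [X.result_append_of_mem hs, X.result_append_of_mem (h.1.mem_iff.1 hs), h.2.2 o hs]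
  · have hs' : o ∉ s' := fun h' => hs (h.1.mem_iff.2 h')
    rw [result, result, takeWhile_ne_append hs, takeWhile_ne_append hs',
      X.stateAfter_append_congr h.2.1]

end OrdEquiv

end SeqObject

/-! ### Confluence of commit orders -/

/-- Operations with commit times, announcement times and the times at which conflict-free
operations took their decision; `order` lists the committed operations by commit time. -/
structure CommitData (O : Type*) where
  com : O → ℕ
  ann : O → ℕ
  Fast : O → ℕ → Prop
  order : List O

namespace CommitData

variable {Q O R : Type*} (D : CommitData O)

/-- One of `a`, `b` is conflict-free and saw the other one announced and uncommitted
(where `a` is committed before `b`). -/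
def Indep (a b : O) : Prop :=
  (∃ t, D.Fast a t ∧ D.ann b ≤ t) ∨ (∃ t, D.Fast b t ∧ D.ann a ≤ t ∧ t < D.com a)

/-- `a` has to stand before `b`. -/
def Req (a b : O) : Prop :=
  D.com a < D.com b ∧ ((∃ t, D.Fast b t ∧ D.com a ≤ t) ∨ ¬ D.Indep a b)

/-- Good lists need not contain all commits, since the confluence induction removes elements.
`closed` keeps in the list everything needed to form the state in which a fast member was tested. -/
structure Good (w : List O) : Prop where
  subset : ∀ a ∈ w, a ∈ D.order
  nodup : w.Nodup
  closed : ∀ x ∈ w, ∀ t, D.Fast x t → ∀ y ∈ D.order, D.com y ≤ t → y ∈ w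
  pairwise : w.Pairwise (fun a b => ¬ D.Req b a)

/-- What the protocol supplies. `slow` is the effect of booking: a consensus commit cannot overtake
a conflict-free operation that decided before its announcement. `comm` is the commutation test, with
the commit order as the tested state. -/
structure Admissible [DecidableEq O] (X : SeqObject Q O R) : Prop where
  sorted : D.order.Pairwise (fun a b => D.com a < D.com b)
  fast_lt : ∀ x ∈ D.order, ∀ t, D.Fast x t → t < D.com x
  slow : ∀ a ∈ D.order, ∀ b ∈ D.order, ∀ t, D.Fast b t → (∀ t', ¬ D.Fast a t') → t < D.ann a →
    D.com b < D.com a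
  comm : ∀ x ∈ D.order, ∀ t, D.Fast x t → ∀ s : List O, s.Nodup →
    (∀ y ∈ s, y ∈ D.order ∧ y ≠ x ∧ D.ann y ≤ t ∧ t < D.com y) →
    X.CommutesSeq x (D.order.filter (fun y => D.com y ≤ t)) s

variable {D}

/-- Whatever a fast `x` saw committed is required before `x`, so `closed` cannot point beyond a
prefix containing `x`. -/
theorem Good.append_left {w w' : List O} (hlt : ∀ x ∈ D.order, ∀ t, D.Fast x t → t < D.com x)
    (h : D.Good (w ++ w')) : D.Good w where
  subset a ha := h.subset a (by simp [ha])
  nodup := h.nodup.of_append_left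
  pairwise := (List.pairwise_append.1 h.pairwise).1
  closed x hx t ht y hy hyt := by
    have hxo := h.subset x (by simp [hx])
    have := h.closed x (by simp [hx]) t ht y hy hyt
    rcases List.mem_append.1 this with h1 | h1
    · exact h1
    · exact absurd ⟨hyt.trans_lt (hlt x hxo t ht), Or.inl ⟨t, ht, hyt⟩⟩
        ((List.pairwise_append.1 h.pairwise).2.2 x hx y h1)

/-- All decisions in the list were taken before `x` was committed, so no closure condition involves
`x`. -/
theorem Good.remove {w1 w2 : List O} {x : O} (h : D.Good (w1 ++ x :: w2))
    (hx : ∀ y ∈ w1 ++ x :: w2, ∀ t, D.Fast y t → t < D.com x) : D.Good (w1 ++ w2) where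
  subset a ha := h.subset a (by simp only [List.mem_append, List.mem_cons] at ha ⊢; tauto)
  nodup := h.nodup.sublist (by simp)
  pairwise := h.pairwise.sublist (by simp)
  closed y hy t ht z hz hzt := by
    have hy' : y ∈ w1 ++ x :: w2 := by
      simp only [List.mem_append, List.mem_cons] at hy ⊢; tauto
    have := h.closed y hy' t ht z hz hzt
    have hzx : z ≠ x := by
      rintro rfl
      exact absurd (hx y hy' t ht) (by omega)
    simp only [List.mem_append, List.mem_cons] at this ⊢; tauto

variable [DecidableEq O] {X : SeqObject Q O R}

theorem Admissible.com_inj (h : D.Admissible X) {a b : O} (ha : a ∈ D.order) (hb : b ∈ D.order)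
    (hab : D.com a = D.com b) : a = b := by
  obtain ⟨i, hi, rfl⟩ := List.getElem_of_mem ha
  obtain ⟨j, hj, rfl⟩ := List.getElem_of_mem hb
  have hs := List.pairwise_iff_getElem.1 h.sorted
  rcases lt_trichotomy i j with hij | rfl | hij
  · exact absurd hab (hs i j hi hj hij).ne
  · rfl
  · exact absurd hab (hs j i hj hi hij).ne'

theorem Admissible.nodup_order (h : D.Admissible X) : D.order.Nodup :=
  h.sorted.imp fun {a b} hab => by rintro rfl; omega

/-- A conflict-free operation with the latest decision can be moved to the end. -/
theorem Good.move_last (h : D.Admissible X) {w1 w2 : List O} {x : O} {t : ℕ}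
    (hw : D.Good (w1 ++ x :: w2)) (hx : D.Fast x t)
    (hann : ∀ y ∈ w1 ++ x :: w2, D.ann y ≤ t)
    (ih : ∀ u, D.Good u → u.Perm w1 → X.OrdEquiv w1 u) :
    X.OrdEquiv (w1 ++ x :: w2) (w1 ++ w2 ++ [x]) := by
  classical
  have hxo : x ∈ D.order := hw.subset x (by simp)
  have hg1 : D.Good w1 := hw.append_left h.fast_lt
  have hnd := hw.nodup
  have hpw := List.pairwise_append.1 hw.pairwise
  -- `bl` is the state in which `x` was tested; `q` is the part of `w1` committed later. By
  -- `closed`, `bl ++ q` rearranges `w1`, and it is again good.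
  set bl := D.order.filter (fun y => D.com y ≤ t) with hbl
  set q := w1.filter (fun y => t < D.com y) with hq
  have hmem1 : ∀ y ∈ D.order, D.com y ≤ t → y ∈ w1 := by
    intro y hy hyt
    have h1 := hw.closed x (by simp) t hx y hy hyt
    have hlt := h.fast_lt x hxo t hx
    simp only [List.mem_append, List.mem_cons] at h1
    rcases h1 with h1 | rfl | h1
    · exact h1
    · omega
    · exact absurd ⟨by omega, Or.inl ⟨t, hx, hyt⟩⟩ ((List.pairwise_cons.1 hpw.2.1).1 y h1)
  have hndu : (bl ++ q).Nodup := by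
    refine List.nodup_append.2 ⟨h.nodup_order.filter _, hg1.nodup.filter _, ?_⟩
    intro a ha b hb hab
    simp only [hbl, hq, List.mem_filter, decide_eq_true_eq] at ha hb
    subst hab
    omega
  have hmemu : ∀ y, y ∈ bl ++ q ↔ y ∈ w1 := by
    intro y
    simp only [hbl, hq, List.mem_append, List.mem_filter, decide_eq_true_eq]
    constructor
    · rintro (⟨h1, h2⟩ | ⟨h1, -⟩)
      · exact hmem1 y h1 h2
      · exact h1
    · intro hy
      by_cases hyt : D.com y ≤ t
      · exact Or.inl ⟨hg1.subset y hy, hyt⟩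
      · exact Or.inr ⟨hy, by omega⟩
  have hgu : D.Good (bl ++ q) := by
    refine ⟨fun a ha => hg1.subset a ((hmemu a).1 ha), hndu, ?_, ?_⟩
    · intro y hy s hs z hz hzs
      exact (hmemu z).2 (hg1.closed y ((hmemu y).1 hy) s hs z hz hzs)
    · refine List.pairwise_append.2 ⟨?_, hg1.pairwise.filter _, ?_⟩
      · exact (h.sorted.filter _).imp fun {a b} hab hr => by have := hr.1; omega
      · intro a ha b hb hr
        have := hr.1
        simp only [hbl, hq, List.mem_filter, decide_eq_true_eq] at ha hb
        omega
  have e1 : X.OrdEquiv w1 (bl ++ q) :=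
    ih _ hgu ((List.perm_ext_iff_of_nodup hndu hg1.nodup).2 hmemu)
  have hmw : ∀ y ∈ q ++ w2, y ∈ D.order ∧ y ≠ x ∧ D.ann y ≤ t ∧ t < D.com y := by
    intro y hy
    have hyw : y ∈ w1 ∨ y ∈ w2 := by
      simp only [hq, List.mem_append, List.mem_filter] at hy; tauto
    have hyo : y ∈ D.order := hw.subset y (by simp; tauto)
    refine ⟨hyo, ?_, hann y (by simp; tauto), ?_⟩
    · rintro rfl
      rw [List.nodup_append] at hnd
      rcases hyw with h1 | h1
      · exact hnd.2.2 y h1 y (by simp) rfl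
      · exact (List.nodup_cons.1 hnd.2.1).1 h1
    · rcases List.mem_append.1 hy with h1 | h1
      · simpa [hq] using (List.mem_filter.1 h1).2
      · by_contra hlt
        have h2 := hmem1 y hyo (by omega)
        exact (List.nodup_append.1 hnd).2.2 y h2 y (by simp [h1]) rfl
  have hndq : (q ++ w2).Nodup := by
    refine hnd.sublist ?_
    exact (List.filter_sublist).append (List.sublist_cons_self _ _)
  -- Commutation is used twice: `x` moves back over `q` to its tested state, then forward over `q ++
  -- w2` at once. Commuting over `w2` alone in state `bl ++ q` is not directly available.
  have c1 : X.OrdEquiv (bl ++ q ++ [x]) (bl ++ [x] ++ q) :=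
    h.comm x hxo t hx q hndq.of_append_left (fun y hy => hmw y (by simp [hy]))
  have c2 : X.OrdEquiv (bl ++ (q ++ w2) ++ [x]) (bl ++ [x] ++ (q ++ w2)) :=
    h.comm x hxo t hx (q ++ w2) hndq hmw
  have s1 := (e1.append_right [x]).append_right w2
  have s2 := c1.append_right w2
  have s3 := (e1.append_right w2).append_right [x]
  simp only [List.append_assoc, List.cons_append, List.nil_append] at s1 s2 s3 c2 ⊢
  exact s1.trans (s2.trans (c2.symm.trans s3.symm))

/-- If some operation was announced after the decisions of all conflict-free operations, then the
operation that was committed last stands last. -/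
theorem Good.last_eq (h : D.Admissible X) {u v : List O} {z z0 : O} {t : ℕ}
    (hw : D.Good (u ++ z :: v)) (hz0 : z0 ∈ u ++ z :: v) (hann : t < D.ann z0)
    (hmax : ∀ y ∈ u ++ z :: v, ∀ s, D.Fast y s → s ≤ t)
    (hfa : ∀ y ∈ u ++ z :: v, ∀ s, D.Fast y s → D.ann y ≤ s)
    (hlast : ∀ y ∈ u ++ z :: v, D.com y ≤ D.com z) : v = [] := by
  -- A fast operation is announced by its decision, hence by `t`; so `z0` is slow.
  have hslow0 : ∀ s, ¬ D.Fast z0 s := fun s hs => by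
    have := hmax z0 hz0 s hs
    have := hfa z0 hz0 s hs
    omega
  have hb : ∀ y ∈ u ++ z :: v, ∀ s, D.Fast y s → D.com y < D.com z0 := fun y hy s hs =>
    h.slow z0 (hw.subset _ hz0) y (hw.subset _ hy) s hs hslow0
      ((hmax y hy s hs).trans_lt hann)
  have hslowz : ∀ s, ¬ D.Fast z s := fun s hs => by
    have := hb z (by simp) s hs
    have := hlast z0 hz0
    omega
  rw [List.eq_nil_iff_forall_not_mem]
  intro a ha
  have haw : a ∈ u ++ z :: v := by simp [ha]
  have hpw := List.pairwise_append.1 hw.pairwise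
  have hpv := List.pairwise_cons.1 hpw.2.1
  have hlt : ∀ b ∈ v, D.com b < D.com z := fun b hb' => by
    have hbw : b ∈ u ++ z :: v := by simp [hb']
    refine lt_of_le_of_ne (hlast b hbw) fun he => ?_
    have := h.com_inj (hw.subset _ hbw) (hw.subset z (by simp)) he
    subst this
    exact (List.nodup_cons.1 (List.nodup_append.1 hw.nodup).2.1).1 hb'
  -- Independence needs a fast member, so slow operations are forced into commit order.
  have hreq : ∀ b c, (∀ s, ¬ D.Fast b s) → (∀ s, ¬ D.Fast c s) → D.com b < D.com c →
      D.Req b c := by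
    intro b c hb hc hbc
    refine ⟨hbc, Or.inr ?_⟩
    rintro (⟨s, hs, -⟩ | ⟨s, hs, -⟩)
    · exact hb s hs
    · exact hc s hs
  by_cases hfast : ∃ s, D.Fast a s
  · obtain ⟨s, hs⟩ := hfast
    -- `z0` was announced after the decision of `a`, so the two are not independent. A fast `a`
    -- behind `z` thus violates the order with `z0`, or `z0` itself stands behind the slow `z`,
    -- which is also forbidden.
    have hreq0 : D.Req a z0 := by
      refine ⟨hb a haw s hs, Or.inr ?_⟩
      rintro (⟨s', hs', h'⟩ | ⟨s', hs', -⟩)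
      · have := hmax a haw s' hs'
        omega
      · exact hslow0 s' hs'
    simp only [List.mem_append, List.mem_cons] at hz0
    rcases hz0 with h0 | rfl | h0
    · exact hpw.2.2 z0 h0 a (by simp [ha]) hreq0
    · exact hpv.1 a ha hreq0
    · exact hpv.1 z0 h0 (hreq z0 z hslow0 hslowz (hlt z0 h0))
  · push Not at hfast
    exact hpv.1 a ha (hreq a z hfast hslowz (hlt a ha))

/-- Each induction step removes the same operation from the end of both lists: the fast one with the
latest decision if all were announced by then, else the one committed last. Good prefixes and
deletions preserve the hypothesis. -/
theorem Admissible.ordEquiv (h : D.Admissible X)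
    (hfa : ∀ x ∈ D.order, ∀ t, D.Fast x t → D.ann x ≤ t) {w w' : List O}
    (hw : D.Good w) (hw' : D.Good w') (hp : w.Perm w') : X.OrdEquiv w w' := by
  classical
  induction hn : w.length using Nat.strong_induction_on generalizing w w' with
  | _ N ih =>
  subst hn
  by_cases hex : ∃ x ∈ w, ∃ t, D.Fast x t
  · obtain ⟨x, hxw, t, hxt, hmax⟩ : ∃ x ∈ w, ∃ t, D.Fast x t ∧
        ∀ y ∈ w, ∀ s, D.Fast y s → s ≤ t := by
      set S : Set ℕ := {t | ∃ x ∈ w, D.Fast x t} with hS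
      have hne : S.Nonempty := by
        obtain ⟨x, hx, t, ht⟩ := hex
        exact ⟨t, x, hx, ht⟩
      have hbd : BddAbove S := by
        refine ⟨(w.map D.com).sum, ?_⟩
        -- Decision times lie below commit times, hence below their sum.
        rintro t ⟨x, hx, ht⟩
        have h1 := h.fast_lt x (hw.subset x hx) t ht
        have h2 : D.com x ≤ (w.map D.com).sum :=
          List.le_sum_of_mem (List.mem_map_of_mem hx)
        omega
      obtain ⟨x, hx, ht⟩ := Nat.sSup_mem hne hbd
      exact ⟨x, hx, _, ht, fun y hy s hs => le_csSup hbd ⟨y, hy, hs⟩⟩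
    by_cases hann : ∀ y ∈ w, D.ann y ≤ t
    · have key : ∀ w : List O, D.Good w → x ∈ w → (∀ y ∈ w, D.ann y ≤ t) →
          (∀ y ∈ w, ∀ s, D.Fast y s → s ≤ t) →
          (∀ u u', D.Good u → D.Good u' → u.Perm u' → u.length < w.length → X.OrdEquiv u u') →
          ∃ v, D.Good v ∧ w.Perm (v ++ [x]) ∧ X.OrdEquiv w (v ++ [x]) := by
        intro w hw hx hann hmax ih
        obtain ⟨w1, w2, rfl⟩ := List.append_of_mem hx
        have hlt := h.fast_lt x (hw.subset x hx) t hxt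
        have := hw.move_last h hxt hann (fun u hu hp =>
          ih _ _ (hw.append_left h.fast_lt) hu hp.symm (by simp))
        exact ⟨w1 ++ w2, hw.remove fun y hy s hs => (hmax y hy s hs).trans_lt hlt, this.1, this⟩
      have ih' : ∀ u u', D.Good u → D.Good u' → u.Perm u' → u.length < w.length →
          X.OrdEquiv u u' := fun u u' hu hu' hp hl => ih _ hl hu hu' hp rfl
      obtain ⟨v, hv, hpv, hev⟩ := key w hw hxw hann hmax ih'
      obtain ⟨v', hv', hpv', hev'⟩ := key w' hw' (hp.mem_iff.1 hxw)
        (fun y hy => hann y (hp.mem_iff.2 hy)) (fun y hy => hmax y (hp.mem_iff.2 hy))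
        (by rw [← hp.length_eq]; exact ih')
      have hvv : v.Perm v' :=
        (List.perm_append_right_iff [x]).1 ((hpv.symm.trans hp).trans hpv')
      have hlen : v.length < w.length := by rw [hpv.length_eq]; simp
      exact hev.trans (((ih' v v' hv hv' hvv hlen).append_right [x]).trans hev'.symm)
    · push Not at hann
      obtain ⟨z0, hz0, hz0t⟩ := hann
      obtain ⟨z, hz, hzmax⟩ : ∃ z ∈ w, ∀ y ∈ w, D.com y ≤ D.com z := by
        obtain ⟨z, hz, h'⟩ := Finset.exists_max_image w.toFinset D.com ⟨x, by simpa using hxw⟩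
        exact ⟨z, by simpa using hz, fun y hy => h' y (by simpa using hy)⟩
      have key : ∀ w : List O, D.Good w → z0 ∈ w → z ∈ w → (∀ y ∈ w, D.com y ≤ D.com z) →
          (∀ y ∈ w, ∀ s, D.Fast y s → s ≤ t) → ∃ u, D.Good u ∧ w = u ++ [z] := by
        intro w hw hz0 hz hzmax hmax
        obtain ⟨u, v, rfl⟩ := List.append_of_mem hz
        have := hw.last_eq h hz0 hz0t hmax (fun y hy => hfa y (hw.subset y hy)) hzmax
        subst this
        exact ⟨u, hw.append_left h.fast_lt, rfl⟩
      obtain ⟨u, hu, rfl⟩ := key w hw hz0 hz hzmax hmax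
      obtain ⟨u', hu', rfl⟩ := key w' hw' (hp.mem_iff.1 hz0) (hp.mem_iff.1 hz)
        (fun y hy => hzmax y (hp.mem_iff.2 hy)) (fun y hy => hmax y (hp.mem_iff.2 hy))
      exact (ih _ (by simp) hu hu' ((List.perm_append_right_iff [z]).1 hp) rfl).append_right [z]
  · push Not at hex
    have key : ∀ w : List O, D.Good w → (∀ x ∈ w, ∀ t, ¬ D.Fast x t) →
        w.Pairwise (fun a b => D.com a < D.com b) := by
      intro w hw hex
      refine (hw.pairwise.and hw.nodup).imp_of_mem ?_
      rintro a b ha hb ⟨hr, hne⟩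
      by_contra hlt
      have hlt' : D.com b < D.com a := lt_of_le_of_ne (not_lt.1 hlt) fun he =>
        hne (h.com_inj (hw.subset a ha) (hw.subset b hb) he.symm)
      refine hr ⟨hlt', Or.inr ?_⟩
      rintro (⟨s, hs, -⟩ | ⟨s, hs, -⟩)
      · exact hex b hb s hs
      · exact hex a ha s hs
    refine .of_eq (List.Perm.eq_of_pairwise ?_ (key w hw hex)
      (key w' hw' fun x hx => hex x (hp.mem_iff.2 hx)) hp)
    intro a b _ _ hab hba
    omega

theorem Admissible.good_order (h : D.Admissible X) : D.Good D.order where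
  subset _ ha := ha
  nodup := h.nodup_order
  closed _ _ _ _ _ hy _ := hy
  pairwise := h.sorted.imp fun {a b} hab hr => by have := hr.1; omega

end CommitData

/-! ### The value read from a snapshot -/

namespace ABCSnapshot

variable {n : ℕ} {O : Type*} [DecidableEq O]

theorem mem_merge_A {T : ABCSnapshot n O} {o : O} : o ∈ T.merge.A ↔ ∃ p, o ∈ T.A p := by
  simp [merge]

theorem exists_mem_of_mem_merge_B {T : ABCSnapshot n O} {x : O × ℕ} (h : x ∈ T.merge.B) :
    ∃ p, x ∈ T.B p := by
  classical
  simp only [merge, Finset.mem_filter, Finset.mem_biUnion, Finset.mem_univ, true_and] at h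
  exact h.1

theorem exists_mem_merge_B {T : ABCSnapshot n O} {o : O} {b : ℕ} {p : Fin n}
    (h : (o, b) ∈ T.B p) : ∃ b' ≤ b, (o, b') ∈ T.merge.B := by
  classical
  obtain ⟨x, hx, hmin⟩ := Finset.exists_min_image
    ((Finset.univ.biUnion T.B).filter fun x => x.1 = o) Prod.snd
    ⟨(o, b), by simpa using ⟨p, h⟩⟩
  obtain ⟨o', b'⟩ := x
  simp only [Finset.mem_filter, Finset.mem_biUnion, Finset.mem_univ, true_and] at hx hmin
  obtain ⟨hx, rfl⟩ := hx
  refine ⟨b', hmin (o', b) ⟨⟨p, h⟩, rfl⟩, ?_⟩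
  simp only [merge, Finset.mem_filter, Finset.mem_biUnion, Finset.mem_univ, true_and]
  exact ⟨hx, fun y hy hyo => hmin y ⟨hy, hyo⟩⟩

theorem mem_vertices_merge {T : ABCSnapshot n O} {o : O} :
    o ∈ T.merge.C.vertices ↔ ∃ p a M, (a, M) ∈ T.C p ∧ (o = a ∨ o ∈ M) := by
  classical
  simp only [merge, DepGraph.vertices, Finset.mem_union, Finset.mem_image, Finset.mem_biUnion,
    Finset.mem_univ, true_and]
  constructor
  · rintro (⟨x, ⟨a, ⟨y, ⟨p, hy⟩, rfl⟩, rfl⟩, rfl⟩ | ⟨x, ⟨a, -, rfl⟩, ho⟩)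
    · exact ⟨p, y.1, y.2, hy, Or.inl rfl⟩
    · simp only [Finset.mem_biUnion, Finset.mem_filter, Finset.mem_univ, true_and] at ho
      obtain ⟨y, ⟨⟨p, hy⟩, -⟩, ho⟩ := ho
      exact ⟨p, y.1, y.2, hy, Or.inr ho⟩
  · rintro ⟨p, a, M, h, rfl | ho⟩
    · exact Or.inl ⟨_, ⟨o, ⟨(o, M), ⟨p, h⟩, rfl⟩, rfl⟩, rfl⟩
    · refine Or.inr ⟨_, ⟨a, ⟨(a, M), ⟨p, h⟩, rfl⟩, rfl⟩, ?_⟩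
      simp only [Finset.mem_biUnion, Finset.mem_filter, Finset.mem_univ, true_and]
      exact ⟨(a, M), ⟨⟨p, h⟩, rfl⟩, ho⟩

theorem edge_merge {T : ABCSnapshot n O} {a b : O} :
    T.merge.C.Edge a b ↔ ∃ p M, (b, M) ∈ T.C p ∧ a ∈ M := by
  classical
  simp only [merge, DepGraph.Edge, Finset.mem_image, Finset.mem_biUnion, Finset.mem_univ,
    true_and, Prod.mk.injEq]
  constructor
  · rintro ⟨M, ⟨o, -, rfl, rfl⟩, ha⟩
    simp only [Finset.mem_biUnion, Finset.mem_filter, Finset.mem_univ, true_and] at ha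
    obtain ⟨⟨o', M⟩, ⟨⟨p, hp⟩, rfl⟩, ha⟩ := ha
    exact ⟨p, M, hp, ha⟩
  · rintro ⟨p, M, h, ha⟩
    refine ⟨_, ⟨b, ⟨(b, M), ⟨p, h⟩, rfl⟩, rfl, rfl⟩, ?_⟩
    simp only [Finset.mem_biUnion, Finset.mem_filter, Finset.mem_univ, true_and]
    exact ⟨(b, M), ⟨⟨p, h⟩, rfl⟩, ha⟩

/-- In the loop the process has booked its own operation, so the minimum is over a nonempty set and
the selection rule applies. -/
theorem exists_isMinBooked {T : ABCSnapshot n O} {o : O} {b : ℕ} {p : Fin n}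
    (h : (o, b) ∈ T.B p) (ho : o ∉ T.merge.C.vertices) : ∃ w, T.merge.IsMinBooked w := by
  classical
  obtain ⟨b', -, hb'⟩ := exists_mem_merge_B h
  obtain ⟨x, hx, hmin⟩ := Finset.exists_min_image
    (T.merge.B.filter fun x => x.1 ∉ T.merge.C.vertices) Prod.snd
    ⟨(o, b'), by simpa using ⟨hb', ho⟩⟩
  simp only [Finset.mem_filter] at hx hmin
  exact ⟨x.1, hx.2, x.2, hx.1, fun y hy hyv => hmin y ⟨hy, hyv⟩⟩

end ABCSnapshot

/-! ### The algorithm as a transition relation, and runs as total sequences of states -/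

namespace UC

open Function

variable {n : ℕ} {Q O R : Type*} [DecidableEq O]

/-- The accesses of a process and their effect, one rule for each value of the program counter. -/
inductive Move (X : SeqObject Q O R) (lin : DepGraph O → List O)
    (sel : Fin n → O → ℕ → ABC O → O) (p : Fin n) :
    Memory n O → Local O R → Access O → Memory n O → Local O R → Prop
  | addA (m RA RB RC op) : Move X lin sel p m ⟨RA, RB, RC, .addA op⟩ (.writeA (insert op RA))
      { m with S := { m.S with A := update m.S.A p (insert op RA) } }
      ⟨insert op RA, RB, RC, .read1 op⟩
  | read1 (m RA RB RC op) : Move X lin sel p m ⟨RA, RB, RC, .read1 op⟩ .snapshotS m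
      ⟨RA, RB, RC, .addB op m.S.merge.A.card⟩
  | addB (m RA RB RC op b) : Move X lin sel p m ⟨RA, RB, RC, .addB op b⟩
      (.writeB (insert (op, b) RB))
      { m with S := { m.S with B := update m.S.B p (insert (op, b) RB) } }
      ⟨RA, insert (op, b) RB, RC, .read2 op⟩
  | read2 (m RA RB RC op) : Move X lin sel p m ⟨RA, RB, RC, .read2 op⟩ .snapshotS m
      ⟨RA, RB, RC, afterRead2 X lin op m.S.merge⟩
  | addC (m RA RB RC op M r) : Move X lin sel p m ⟨RA, RB, RC, .addC op M r⟩
      (.writeC (insert (op, M) RC))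
      { m with S := { m.S with C := update m.S.C p (insert (op, M) RC) } }
      ⟨RA, RB, insert (op, M) RC, .ret r⟩
  | readK (m RA RB RC op) : Move X lin sel p m ⟨RA, RB, RC, .readK op⟩ .snapshotK m
      ⟨RA, RB, RC, .loopRead1 op (Finset.univ.sup m.K + 1)⟩
  | loopRead1_ret (m RA RB RC op k) (h : op ∈ m.S.merge.C.vertices) :
      Move X lin sel p m ⟨RA, RB, RC, .loopRead1 op k⟩ .snapshotS m
        ⟨RA, RB, RC, .ret (X.result (lin m.S.merge.C) op)⟩
  | loopRead1 (m RA RB RC op k) (h : op ∉ m.S.merge.C.vertices) :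
      Move X lin sel p m ⟨RA, RB, RC, .loopRead1 op k⟩ .snapshotS m
        ⟨RA, RB, RC, .propose op k (sel p op k m.S.merge)⟩
  | propose_decided (m RA RB RC op k w w') (h : m.cons k = some w') :
      Move X lin sel p m ⟨RA, RB, RC, .propose op k w⟩ (.propose k w) m
        ⟨RA, RB, RC, .loopRead2 op k w'⟩
  | propose (m RA RB RC op k w) (h : m.cons k = none) :
      Move X lin sel p m ⟨RA, RB, RC, .propose op k w⟩ (.propose k w)
        { m with cons := update m.cons k (some w) }
        ⟨RA, RB, RC, .loopRead2 op k w⟩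
  | loopRead2 (m RA RB RC op k w) (h : w ∉ m.S.merge.C.vertices) :
      Move X lin sel p m ⟨RA, RB, RC, .loopRead2 op k w⟩ .snapshotS m
        ⟨RA, RB, RC, .loopAddC op k w m.S.merge.C.vertices⟩
  | loopRead2_skip (m RA RB RC op k w) (h : w ∈ m.S.merge.C.vertices) :
      Move X lin sel p m ⟨RA, RB, RC, .loopRead2 op k w⟩ .snapshotS m
        ⟨RA, RB, RC, .writeK op k⟩
  | loopAddC (m RA RB RC op k w M) : Move X lin sel p m ⟨RA, RB, RC, .loopAddC op k w M⟩
      (.writeC (insert (w, M) RC))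
      { m with S := { m.S with C := update m.S.C p (insert (w, M) RC) } }
      ⟨RA, RB, insert (w, M) RC, .writeK op k⟩
  | writeK (m RA RB RC op k) : Move X lin sel p m ⟨RA, RB, RC, .writeK op k⟩ (.writeK k)
      { m with K := update m.K p k } ⟨RA, RB, RC, .loopRead1 op (k + 1)⟩

/-- This replaces the functions `next`, `applyAccess` and `cont` by a relation, so that invariants
are checked by cases on `Move`. -/
theorem Move.of_next {X : SeqObject Q O R} {lin : DepGraph O → List O}
    {sel : Fin n → O → ℕ → ABC O → O} {p : Fin n} (m : Memory n O) {L : Local O R} {a : Access O}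
    (h : next L = .access a) :
    Move X lin sel p m L a (applyAccess p a m).2
      (cont X lin sel p (applyAccess p a m).1 L) := by
  obtain ⟨RA, RB, RC, pc⟩ := L
  cases pc <;> simp only [next, NextAction.access.injEq, reduceCtorEq] at h
  case propose op k w =>
    subst h
    cases hk : m.cons k with
    | none => simpa [applyAccess, cont, hk] using Move.propose m RA RB RC op k w hk
    | some w' => simpa [applyAccess, cont, hk] using Move.propose_decided m RA RB RC op k w w' hk
  case loopRead1 op k =>
    subst h
    by_cases hv : op ∈ m.S.merge.C.vertices
    · simpa [applyAccess, cont, hv] using Move.loopRead1_ret m RA RB RC op k hv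
    · simpa [applyAccess, cont, hv] using Move.loopRead1 m RA RB RC op k hv
  case loopRead2 op k w =>
    subst h
    by_cases hv : w ∈ m.S.merge.C.vertices
    · simpa [applyAccess, cont, hv] using Move.loopRead2_skip m RA RB RC op k w hv
    · simpa [applyAccess, cont, hv] using Move.loopRead2 m RA RB RC op k w hv
  all_goals subst h; constructor

/-- The sequence of global states of a run of the universal construction; after the end of a
finite run the state remains unchanged. -/
structure Trace (n : ℕ) (X : SeqObject Q O R) (lin : DepGraph O → List O)
    (sel : Fin n → O → ℕ → ABC O → O) where
  mem : ℕ → Memory n O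
  loc : ℕ → Fin n → Local O R
  cur : ℕ → Fin n → Option O
  ev : ℕ → Option (Event (Fin n) O R (Access O))
  mem_zero : mem 0 = ⟨⟨fun _ => ∅, fun _ => ∅, fun _ => ∅⟩, fun _ => 0, fun _ => none⟩
  loc_zero : loc 0 = fun _ => ⟨∅, ∅, ∅, .idle⟩
  cur_zero : cur 0 = fun _ => none
  step : ∀ i,
    (ev i = none ∧ mem (i + 1) = mem i ∧ loc (i + 1) = loc i ∧ cur (i + 1) = cur i) ∨
    (∃ p op, ev i = some (.inv p op) ∧ cur i p = none ∧ mem (i + 1) = mem i ∧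
      loc (i + 1) = update (loc i) p { loc i p with pc := .addA op } ∧
      cur (i + 1) = update (cur i) p (some op)) ∨
    (∃ p op a L, ev i = some (.step p op a) ∧ cur i p = some op ∧
      Move X lin sel p (mem i) (loc i p) a (mem (i + 1)) L ∧
      loc (i + 1) = update (loc i) p L ∧ cur (i + 1) = cur i) ∨
    (∃ p op r, ev i = some (.res p op r) ∧ cur i p = some op ∧ (loc i p).pc = .ret r ∧
      mem (i + 1) = mem i ∧ loc (i + 1) = update (loc i) p { loc i p with pc := .idle } ∧
      cur (i + 1) = update (cur i) p none)
  inv_unique : ∀ i j p p' op, ev i = some (.inv p op) → ev j = some (.inv p' op) → i = j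

namespace Trace

variable {X : SeqObject Q O R} {lin : DepGraph O → List O} {sel : Fin n → O → ℕ → ABC O → O}

open Classical in
/-- The global states of a run, constant after its end. -/
noncomputable def runConfig (ρ : (impl n X lin sel).Run) : ℕ → (impl n X lin sel).Config
  | 0 => ρ.config 0
  | i + 1 => if (ρ.events.get? i).isSome then ρ.config (i + 1) else runConfig ρ i

theorem runConfig_eq (ρ : (impl n X lin sel).Run) {i : ℕ} (h : (ρ.events.get? i).isSome) :
    runConfig ρ i = ρ.config i := by
  cases i with
  | zero => rfl
  | succ i =>
    rw [runConfig, if_pos]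
    obtain ⟨e, he⟩ := Option.isSome_iff_exists.1 h
    obtain ⟨e', he'⟩ := ρ.events.ge_stable (Nat.le_succ i) he
    simp [he']

/-- The configurations of a finite run are arbitrary after its end; freezing them keeps all
invariants valid at every time. -/
noncomputable def ofRun (ρ : (impl n X lin sel).Run) : Trace n X lin sel where
  mem i := (runConfig ρ i).mem
  loc i := (runConfig ρ i).loc
  cur i := (runConfig ρ i).cur
  ev i := ρ.events.get? i
  mem_zero := by rw [runConfig, ρ.config_zero]; rfl
  loc_zero := by rw [runConfig, ρ.config_zero]; rfl
  cur_zero := by rw [runConfig, ρ.config_zero]; rfl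
  inv_unique := ρ.inv_unique
  step i := by
    cases he : ρ.events.get? i with
    | none =>
      left
      have : runConfig ρ (i + 1) = runConfig ρ i := by rw [runConfig, he]; simp
      rw [this]
      exact ⟨rfl, rfl, rfl, rfl⟩
    | some e =>
      right
      have h1 : runConfig ρ i = ρ.config i := runConfig_eq ρ (by simp [he])
      have h2 : runConfig ρ (i + 1) = ρ.config (i + 1) := by rw [runConfig, he]; simp
      rw [h1, h2]
      have hs := ρ.step i e he
      generalize ρ.config i = c at hs
      generalize ρ.config (i + 1) = c' at hs
      cases hs with
      | inv p op hc => exact Or.inl ⟨p, op, rfl, hc, rfl, rfl, rfl⟩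
      | step p op a hc ha =>
        exact Or.inr (Or.inl ⟨p, op, a, _, rfl, hc, Move.of_next c.mem ha, rfl, rfl⟩)
      | res p op r hc hr =>
        refine Or.inr (Or.inr ⟨p, op, r, rfl, hc, ?_, rfl, rfl, rfl⟩)
        change next (c.loc p) = .ret r at hr
        revert hr
        generalize c.loc p = L
        obtain ⟨RA, RB, RC, pc⟩ := L
        cases pc <;> simp [next]

end Trace

end UC

/-! ### Monotonicity of the shared memory and the invariants of the program counter -/

namespace UC

open Function

variable {n : ℕ} {Q O R : Type*}

/-- The local copies of a process agree with its components of the snapshot object. -/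
def Mirrors (L : Local O R) (T : ABCSnapshot n O) (p : Fin n) : Prop :=
  L.RA = T.A p ∧ L.RB = T.B p ∧ L.RC = T.C p

/-- `K` is left out: the proof uses only that each of its entries is settled, not that it grows. -/
structure Memory.Le (m m' : Memory n O) : Prop where
  A : ∀ p, m.S.A p ⊆ m'.S.A p
  B : ∀ p, m.S.B p ⊆ m'.S.B p
  C : ∀ p, m.S.C p ⊆ m'.S.C p
  cons : ∀ k w, m.cons k = some w → m'.cons k = some w

theorem Memory.Le.refl (m : Memory n O) : m.Le m :=
  ⟨fun _ => subset_rfl, fun _ => subset_rfl, fun _ => subset_rfl, fun _ _ h => h⟩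

theorem Memory.Le.trans {m m' m'' : Memory n O} (h : m.Le m') (h' : m'.Le m'') : m.Le m'' :=
  ⟨fun p => (h.A p).trans (h'.A p), fun p => (h.B p).trans (h'.B p),
    fun p => (h.C p).trans (h'.C p), fun k w hw => h'.cons k w (h.cons k w hw)⟩

theorem subset_update_insert {ι α : Type*} [DecidableEq ι] [DecidableEq α] (f : ι → Finset α)
    (p : ι) (x : α) (s : Finset α) (h : s = f p) (q : ι) : f q ⊆ update f p (insert x s) q := by
  by_cases hq : q = p
  · subst hq; subst h; simp
  · simp [hq]

theorem mem_update_insert {ι α : Type*} [DecidableEq ι] [DecidableEq α] {f : ι → Finset α}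
    {p : ι} {x y : α} {s : Finset α} (h : s = f p) {q : ι} (hy : y ∈ update f p (insert x s) q) :
    y ∈ f q ∨ (q = p ∧ y = x) := by
  by_cases hq : q = p
  · subst hq; subst h
    simp only [update_self, Finset.mem_insert] at hy
    tauto
  · simp only [update_of_ne hq] at hy
    exact Or.inl hy

namespace Move

variable [DecidableEq O] {X : SeqObject Q O R} {lin : DepGraph O → List O} {sel : Fin n → O → ℕ → ABC O → O}
  {p : Fin n} {m m' : Memory n O} {L L' : Local O R} {a : Access O}

/-- A write replaces a whole component by the enlarged local copy; it only adds because the copy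
agrees with the component. -/
theorem le (h : Move X lin sel p m L a m' L') (hL : Mirrors L m.S p) : m.Le m' := by
  obtain ⟨hA, hB, hC⟩ := hL
  cases h <;> first
    | exact Memory.Le.refl _
    | exact ⟨subset_update_insert _ _ _ _ hA, fun _ => subset_rfl, fun _ => subset_rfl,
        fun _ _ h => h⟩
    | exact ⟨fun _ => subset_rfl, subset_update_insert _ _ _ _ hB, fun _ => subset_rfl,
        fun _ _ h => h⟩
    | exact ⟨fun _ => subset_rfl, fun _ => subset_rfl, subset_update_insert _ _ _ _ hC,
        fun _ _ h => h⟩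
    | exact ⟨fun _ => subset_rfl, fun _ => subset_rfl, fun _ => subset_rfl, fun _ _ h => h⟩
    | skip
  case propose RA RB RC op k w h =>
    refine ⟨fun _ => subset_rfl, fun _ => subset_rfl, fun _ => subset_rfl, fun j w' hj => ?_⟩
    have : j ≠ k := by rintro rfl; simp [h] at hj
    simpa [this] using hj

theorem mirrors (h : Move X lin sel p m L a m' L') (hL : Mirrors L m.S p) :
    Mirrors L' m'.S p := by
  obtain ⟨hA, hB, hC⟩ := hL
  cases h <;> refine ⟨?_, ?_, ?_⟩ <;> simp_all

theorem mirrors_of_ne (h : Move X lin sel p m L a m' L') {q : Fin n} (hq : q ≠ p)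
    {K : Local O R} (hK : Mirrors K m.S q) : Mirrors K m'.S q := by
  obtain ⟨hA, hB, hC⟩ := hK
  cases h <;> refine ⟨?_, ?_, ?_⟩ <;> simp_all

theorem mem_A (h : Move X lin sel p m L a m' L') (hL : Mirrors L m.S p) {q : Fin n} {o : O}
    (ho : o ∈ m'.S.A q) : o ∈ m.S.A q ∨ L.pc = .addA o := by
  obtain ⟨hA, hB, hC⟩ := hL
  cases h <;> first
    | exact Or.inl ho
    | skip
  case addA =>
    rcases mem_update_insert hA ho with h | ⟨-, rfl⟩
    · exact Or.inl h
    · exact Or.inr rfl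

theorem mem_B (h : Move X lin sel p m L a m' L') (hL : Mirrors L m.S p) {q : Fin n} {o : O}
    {b : ℕ} (ho : (o, b) ∈ m'.S.B q) : (o, b) ∈ m.S.B q ∨ L.pc = .addB o b := by
  obtain ⟨hA, hB, hC⟩ := hL
  cases h <;> first
    | exact Or.inl ho
    | skip
  case addB =>
    rcases mem_update_insert hB ho with h | ⟨-, h⟩
    · exact Or.inl h
    · cases h; exact Or.inr rfl

theorem mem_C (h : Move X lin sel p m L a m' L') (hL : Mirrors L m.S p) {q : Fin n} {o : O}
    {M : Finset O} (ho : (o, M) ∈ m'.S.C q) : (o, M) ∈ m.S.C q ∨ (∃ r, L.pc = .addC o M r) ∨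
      ∃ op k, L.pc = .loopAddC op k o M := by
  obtain ⟨hA, hB, hC⟩ := hL
  cases h <;> first
    | exact Or.inl ho
    | skip
  case addC =>
    rcases mem_update_insert hC ho with h | ⟨-, h⟩
    · exact Or.inl h
    · cases h; exact Or.inr (Or.inl ⟨_, rfl⟩)
  case loopAddC =>
    rcases mem_update_insert hC ho with h | ⟨-, h⟩
    · exact Or.inl h
    · cases h; exact Or.inr (Or.inr ⟨_, _, rfl⟩)

theorem mem_cons (h : Move X lin sel p m L a m' L') {k : ℕ} {w : O} (hw : m'.cons k = some w) :
    m.cons k = some w ∨ ∃ op, L.pc = .propose op k w := by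
  cases h <;> first
    | exact Or.inl hw
    | skip
  case propose RA RB RC op j w' h =>
    by_cases hk : k = j
    · subst hk
      simp only [update_self, Option.some.injEq] at hw
      subst hw
      exact Or.inr ⟨op, rfl⟩
    · simp only [update_of_ne hk] at hw
      exact Or.inl hw

theorem K_eq (h : Move X lin sel p m L a m' L') (q : Fin n) :
    m'.K q = m.K q ∨ (q = p ∧ ∃ op, L.pc = .writeK op (m'.K q)) := by
  cases h <;> first
    | exact Or.inl rfl
    | skip
  case writeK =>
    by_cases hq : q = p
    · subst hq; right; simp
    · left; simp [hq]

end Move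

namespace Trace

variable [DecidableEq O] {X : SeqObject Q O R} {lin : DepGraph O → List O} {sel : Fin n → O → ℕ → ABC O → O}
  (τ : Trace n X lin sel)

theorem mirrors (i : ℕ) (p : Fin n) : Mirrors (τ.loc i p) (τ.mem i).S p := by
  induction i with
  | zero => rw [τ.mem_zero, τ.loc_zero]; exact ⟨rfl, rfl, rfl⟩
  | succ i ih =>
    rcases τ.step i with ⟨-, hm, hl, -⟩ | ⟨q, op, -, -, hm, hl, -⟩ | ⟨q, op, a, L, -, -, hmv, hl, -⟩ |
      ⟨q, op, r, -, -, -, hm, hl, -⟩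
    · rw [hm, hl]; exact ih
    · rw [hm, hl]
      by_cases h : p = q
      · subst h; rw [update_self]; exact ih
      · simpa [h] using ih
    · rw [hl]
      by_cases h : p = q
      · subst h; simpa using hmv.mirrors ih
      · simpa [h] using hmv.mirrors_of_ne h ih
    · rw [hm, hl]
      by_cases h : p = q
      · subst h; rw [update_self]; exact ih
      · simpa [h] using ih

theorem mem_le_succ (i : ℕ) : (τ.mem i).Le (τ.mem (i + 1)) := by
  rcases τ.step i with ⟨-, hm, -⟩ | ⟨q, op, -, -, hm, -⟩ | ⟨q, op, a, L, -, -, hmv, -⟩ |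
      ⟨q, op, r, -, -, -, hm, -⟩
  · rw [hm]; exact .refl _
  · rw [hm]; exact .refl _
  · exact hmv.le (τ.mirrors i q)
  · rw [hm]; exact .refl _

theorem mem_le {i j : ℕ} (h : i ≤ j) : (τ.mem i).Le (τ.mem j) := by
  induction h with
  | refl => exact .refl _
  | step _ ih => exact ih.trans (τ.mem_le_succ _)

/-- The value of the Announce-Book-Commit graph at time `i`. -/
noncomputable def val (i : ℕ) : ABC O := (τ.mem i).S.merge

/-- The announced operations at time `i`. -/
noncomputable def A (i : ℕ) : Finset O := (τ.val i).A

/-- The committed operations at time `i`. -/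
noncomputable def V (i : ℕ) : Finset O := (τ.val i).C.vertices

def BookedWith (i : ℕ) (o : O) (b : ℕ) : Prop := ∃ p, (o, b) ∈ (τ.mem i).S.B p

/-- At time `i`, the operation `o` has been committed with the predecessors `M`. -/
def Dep (i : ℕ) (o : O) (M : Finset O) : Prop := ∃ p, (o, M) ∈ (τ.mem i).S.C p

/-- All consensus objects before `CONS_k` are decided and their decisions are committed. -/
def Settled (i k : ℕ) : Prop := ∀ m, 1 ≤ m → m < k → ∃ w, (τ.mem i).cons m = some w ∧ w ∈ τ.V i

def CommutesAt (t : ℕ) (o : O) : Prop :=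
  ∀ O' ⊆ (τ.A t \ τ.V t) \ {o}, X.CommutesSet o (lin (τ.val t).C) (O' : Set O)

def SecondReadAt (p : Fin n) (o : O) (t : ℕ) : Prop :=
  τ.ev t = some (.step p o .snapshotS) ∧ (τ.loc t p).pc = .read2 o ∧ o ∉ τ.V t

/-- At time `t`, `publish(o)` decides to commit `o` on the conflict-free path. -/
def FastAt (o : O) (t : ℕ) : Prop := (∃ p, τ.SecondReadAt p o t) ∧ τ.CommutesAt t o

/-- The failed test is remembered by the invariant throughout the loop, so it is still available at
a proposal. -/
def SlowRead (i : ℕ) (p : Fin n) (o : O) : Prop :=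
  ∃ t < i, τ.SecondReadAt p o t ∧ ¬ τ.CommutesAt t o

/-- The reason why `o` may respond with `r`. -/
def Responds (i : ℕ) (o : O) (r : R) : Prop :=
  (∃ j ≤ i, o ∈ τ.V j ∧ r = X.result (lin (τ.val j).C) o) ∨
  ∃ t < i, τ.FastAt o t ∧ τ.Dep i o (τ.V t) ∧ r = X.result (lin (τ.val t).C ++ [o]) o

/-- The invariant of a process, by its program counter. -/
def PCInv (i : ℕ) (p : Fin n) : PC O R → Prop
  | .idle => τ.cur i p = none
  | .addA op => τ.cur i p = some op
  | .read1 op => τ.cur i p = some op ∧ op ∈ τ.A i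
  | .addB op b => τ.cur i p = some op ∧ ∃ j ≤ i, op ∈ τ.A j ∧ b = (τ.A j).card
  | .read2 op => τ.cur i p = some op ∧ op ∈ τ.A i ∧ ∃ b, τ.BookedWith i op b
  | .addC op M r => τ.cur i p = some op ∧
      ∃ t < i, τ.FastAt op t ∧ M = τ.V t ∧ r = X.result (lin (τ.val t).C ++ [op]) op
  | .readK op => τ.cur i p = some op ∧ τ.SlowRead i p op ∧ ∃ b, τ.BookedWith i op b
  | .loopRead1 op k => τ.cur i p = some op ∧ τ.SlowRead i p op ∧ (∃ b, τ.BookedWith i op b) ∧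
      1 ≤ k ∧ τ.Settled i k
  | .propose op k w => τ.cur i p = some op ∧ τ.SlowRead i p op ∧ (∃ b, τ.BookedWith i op b) ∧
      1 ≤ k ∧ ∃ j ≤ i, (τ.val j).IsMinBooked w ∧ τ.Settled j k
  | .loopRead2 op k w => τ.cur i p = some op ∧ τ.SlowRead i p op ∧ (∃ b, τ.BookedWith i op b) ∧
      1 ≤ k ∧ τ.Settled i k ∧ (τ.mem i).cons k = some w
  | .loopAddC op k w M => τ.cur i p = some op ∧ τ.SlowRead i p op ∧
      (∃ b, τ.BookedWith i op b) ∧ 1 ≤ k ∧ τ.Settled i k ∧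
      ∃ j ≤ i, (τ.mem j).cons k = some w ∧ w ∉ τ.V j ∧ M = τ.V j
  | .writeK op k => τ.cur i p = some op ∧ τ.SlowRead i p op ∧ (∃ b, τ.BookedWith i op b) ∧
      1 ≤ k ∧ τ.Settled i (k + 1)
  | .ret r => ∃ o, τ.cur i p = some o ∧ τ.Responds i o r

variable {τ}

theorem mem_A {i : ℕ} {o : O} : o ∈ τ.A i ↔ ∃ p, o ∈ (τ.mem i).S.A p :=
  ABCSnapshot.mem_merge_A

theorem mem_V {i : ℕ} {o : O} : o ∈ τ.V i ↔ ∃ a M, τ.Dep i a M ∧ (o = a ∨ o ∈ M) := by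
  refine ABCSnapshot.mem_vertices_merge.trans ⟨?_, ?_⟩
  · rintro ⟨p, a, M, h, h'⟩; exact ⟨a, M, ⟨p, h⟩, h'⟩
  · rintro ⟨a, M, ⟨p, h⟩, h'⟩; exact ⟨p, a, M, h, h'⟩

theorem edge_iff {i : ℕ} {a b : O} : (τ.val i).C.Edge a b ↔ ∃ M, τ.Dep i b M ∧ a ∈ M := by
  refine ABCSnapshot.edge_merge.trans ⟨?_, ?_⟩
  · rintro ⟨p, M, h, h'⟩; exact ⟨M, ⟨p, h⟩, h'⟩
  · rintro ⟨M, ⟨p, h⟩, h'⟩; exact ⟨p, M, h, h'⟩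

theorem Dep.mono {i j : ℕ} (h : i ≤ j) {o : O} {M : Finset O} (hd : τ.Dep i o M) :
    τ.Dep j o M := hd.imp fun p hp => (τ.mem_le h).C p hp

theorem BookedWith.mono {i j : ℕ} (h : i ≤ j) {o : O} {b : ℕ} (hd : τ.BookedWith i o b) :
    τ.BookedWith j o b := hd.imp fun p hp => (τ.mem_le h).B p hp

theorem A_mono {i j : ℕ} (h : i ≤ j) : τ.A i ⊆ τ.A j := fun o ho => by
  obtain ⟨p, hp⟩ := mem_A.1 ho
  exact mem_A.2 ⟨p, (τ.mem_le h).A p hp⟩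

theorem V_mono {i j : ℕ} (h : i ≤ j) : τ.V i ⊆ τ.V j := fun o ho => by
  obtain ⟨a, M, hd, h'⟩ := mem_V.1 ho
  exact mem_V.2 ⟨a, M, hd.mono h, h'⟩

theorem cons_mono {i j : ℕ} (h : i ≤ j) {k : ℕ} {w : O} (hw : (τ.mem i).cons k = some w) :
    (τ.mem j).cons k = some w := (τ.mem_le h).cons k w hw

theorem Settled.mono {i j k : ℕ} (h : i ≤ j) (hs : τ.Settled i k) : τ.Settled j k :=
  fun m h1 h2 => by
    obtain ⟨w, hw, hV⟩ := hs m h1 h2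
    exact ⟨w, cons_mono h hw, V_mono h hV⟩

theorem Settled.succ {i k : ℕ} {w : O} (hs : τ.Settled i k) (hw : (τ.mem i).cons k = some w)
    (hV : w ∈ τ.V i) : τ.Settled i (k + 1) := fun m h1 h2 => by
  rcases Nat.lt_succ_iff_lt_or_eq.1 h2 with h | rfl
  · exact hs m h1 h
  · exact ⟨w, hw, hV⟩

theorem SlowRead.mono {i j : ℕ} (h : i ≤ j) {p : Fin n} {o : O} (hs : τ.SlowRead i p o) :
    τ.SlowRead j p o := by
  obtain ⟨t, ht, hr⟩ := hs
  exact ⟨t, by omega, hr⟩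

theorem Responds.mono {i j : ℕ} (h : i ≤ j) {o : O} {r : R} (hr : τ.Responds i o r) :
    τ.Responds j o r := by
  rcases hr with ⟨t, ht, hr⟩ | ⟨t, ht, hf, hd, hr⟩
  · exact Or.inl ⟨t, by omega, hr⟩
  · exact Or.inr ⟨t, by omega, hf, hd.mono h, hr⟩

theorem PCInv.mono {i j : ℕ} (h : i ≤ j) {p : Fin n} {pc : PC O R}
    (hc : τ.cur j p = τ.cur i p) (hp : τ.PCInv i p pc) : τ.PCInv j p pc := by
  cases pc <;> simp only [PCInv, hc] at hp ⊢
  case idle => exact hp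
  case addA => exact hp
  case read1 => exact ⟨hp.1, A_mono h hp.2⟩
  case addB =>
    obtain ⟨h1, t, ht, h2⟩ := hp
    exact ⟨h1, t, by omega, h2⟩
  case read2 => exact ⟨hp.1, A_mono h hp.2.1, hp.2.2.imp fun _ => .mono h⟩
  case addC =>
    obtain ⟨h1, t, ht, h2⟩ := hp
    exact ⟨h1, t, by omega, h2⟩
  case readK => exact ⟨hp.1, hp.2.1.mono h, hp.2.2.imp fun _ => .mono h⟩
  case loopRead1 =>
    obtain ⟨h1, h2, h3, h4, h5⟩ := hp
    exact ⟨h1, h2.mono h, h3.imp fun _ => .mono h, h4, h5.mono h⟩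
  case propose =>
    obtain ⟨h1, h2, h3, h4, t, ht, h5⟩ := hp
    exact ⟨h1, h2.mono h, h3.imp fun _ => .mono h, h4, t, by omega, h5⟩
  case loopRead2 =>
    obtain ⟨h1, h2, h3, h4, h5, h6⟩ := hp
    exact ⟨h1, h2.mono h, h3.imp fun _ => .mono h, h4, h5.mono h, cons_mono h h6⟩
  case loopAddC =>
    obtain ⟨h1, h2, h3, h4, h5, t, ht, h6⟩ := hp
    exact ⟨h1, h2.mono h, h3.imp fun _ => .mono h, h4, h5.mono h, t, by omega, h6⟩
  case writeK =>
    obtain ⟨h1, h2, h3, h4, h5⟩ := hp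
    exact ⟨h1, h2.mono h, h3.imp fun _ => .mono h, h4, h5.mono h⟩
  case ret =>
    obtain ⟨o, h1, h2⟩ := hp
    exact ⟨o, h1, h2.mono h⟩

/-- The choice rule selects a booked and uncommitted operation of minimal `B`-value. -/
def SelectsMin (sel : Fin n → O → ℕ → ABC O → O) : Prop :=
  ∀ (p : Fin n) (op : O) (k : ℕ) (v : ABC O),
    (∃ w, v.IsMinBooked w) → v.IsMinBooked (sel p op k v)

/-- The hypothesis on `K` enters only at `readK`, where it starts the loop with a settled index. -/
theorem PCInv.move (hsel : SelectsMin sel) {i : ℕ} {p : Fin n} {op : O} {a : Access O}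
    {L : Local O R} (hK : ∀ q, τ.Settled i ((τ.mem i).K q + 1))
    (hev : τ.ev i = some (.step p op a)) (hcur : τ.cur i p = some op)
    (hcur' : τ.cur (i + 1) p = τ.cur i p)
    (hmv : Move X lin sel p (τ.mem i) (τ.loc i p) a (τ.mem (i + 1)) L)
    (hinv : τ.PCInv i p (τ.loc i p).pc) : τ.PCInv (i + 1) p L.pc := by
  have hle : i ≤ i + 1 := Nat.le_succ i
  generalize hm : τ.mem i = m at hmv
  generalize hL : τ.loc i p = K at hmv hinv
  generalize hm' : τ.mem (i + 1) = m' at hmv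
  have hval : τ.val i = m.S.merge := by rw [val, hm]
  cases hmv <;> simp only [PCInv, hcur', hcur, Option.some.injEq] at hinv ⊢
  case addA RA RB RC o =>
    exact ⟨hinv, mem_A.2 ⟨p, by rw [hm']; simp⟩⟩
  case read1 RA RB RC o =>
    refine ⟨hinv.1, i, hle, hinv.2, ?_⟩
    rw [A, hval]
  case addB RA RB RC o b =>
    obtain ⟨h1, j, hj, h2, h3⟩ := hinv
    exact ⟨h1, A_mono (by omega) h2, b, p, by rw [hm']; simp⟩
  case read2 RA RB RC o =>
    obtain ⟨rfl, h2, h3⟩ := hinv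
    rw [← hval]
    have hpc' : (τ.loc i p).pc = .read2 op := by rw [hL]
    unfold afterRead2
    split_ifs with hv hc
    · exact ⟨op, rfl, Or.inl ⟨i, hle, hv, rfl⟩⟩
    · exact ⟨rfl, i, by omega, ⟨⟨p, hev, hpc', hv⟩, hc⟩, rfl, rfl⟩
    · exact ⟨rfl, ⟨i, by omega, ⟨hev, hpc', hv⟩, hc⟩, h3.imp fun _ => .mono hle⟩
  case addC RA RB RC o M r =>
    obtain ⟨rfl, t, ht, hf, rfl, hr⟩ := hinv
    refine ⟨op, rfl, Or.inr ⟨t, by omega, hf, ⟨p, ?_⟩, hr⟩⟩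
    rw [hm']; simp
  case readK RA RB RC o =>
    obtain ⟨h1, h2, h3⟩ := hinv
    refine ⟨h1, h2.mono hle, h3.imp fun _ => .mono hle, by omega, fun j hj1 hj2 => ?_⟩
    -- Since `1 ≤ j`, an index up to the supremum lies below a single entry `K q`, whose settledness
    -- covers it.
    obtain ⟨q, -, hq⟩ := (Finset.le_sup_iff (show ⊥ < j from hj1)).1 (Nat.lt_succ_iff.1 hj2)
    exact (hK q).mono hle j hj1 (by rw [hm]; omega)
  case loopRead1_ret RA RB RC o k hv =>
    obtain ⟨rfl, -⟩ := hinv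
    rw [← hval] at hv ⊢
    exact ⟨op, rfl, Or.inl ⟨i, hle, hv, rfl⟩⟩
  case loopRead1 RA RB RC o k hv =>
    obtain ⟨rfl, h2, h3, h4, h5⟩ := hinv
    refine ⟨rfl, h2.mono hle, h3.imp fun _ => .mono hle, h4, i, hle, ?_, h5⟩
    obtain ⟨b, q, hb⟩ := h3
    rw [hm] at hb
    rw [hval]
    exact hsel p op k _ (ABCSnapshot.exists_isMinBooked hb hv)
  case propose_decided RA RB RC o k w w' hk =>
    obtain ⟨h1, h2, h3, h4, j, hj, -, h5⟩ := hinv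
    exact ⟨h1, h2.mono hle, h3.imp fun _ => .mono hle, h4, h5.mono (by omega), by rw [hm']; exact hk⟩
  case propose RA RB RC o k w hk =>
    obtain ⟨h1, h2, h3, h4, j, hj, -, h5⟩ := hinv
    exact ⟨h1, h2.mono hle, h3.imp fun _ => .mono hle, h4, h5.mono (by omega), by rw [hm']; simp⟩
  case loopRead2 RA RB RC o k w hv =>
    obtain ⟨h1, h2, h3, h4, h5, h6⟩ := hinv
    rw [← hval] at hv ⊢
    exact ⟨h1, h2.mono hle, h3.imp fun _ => .mono hle, h4, h5.mono hle, i, hle, h6, hv, rfl⟩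
  case loopRead2_skip RA RB RC o k w hv =>
    obtain ⟨h1, h2, h3, h4, h5, h6⟩ := hinv
    rw [← hval] at hv
    exact ⟨h1, h2.mono hle, h3.imp fun _ => .mono hle, h4, (h5.succ h6 hv).mono hle⟩
  case loopAddC RA RB RC o k w M =>
    obtain ⟨h1, h2, h3, h4, h5, j, hj, h6, -⟩ := hinv
    refine ⟨h1, h2.mono hle, h3.imp fun _ => .mono hle, h4,
      (h5.mono hle).succ (cons_mono (by omega) h6) (mem_V.2 ⟨w, M, ⟨p, ?_⟩, Or.inl rfl⟩)⟩
    rw [hm']; simp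
  case writeK RA RB RC o k =>
    obtain ⟨h1, h2, h3, h4, h5⟩ := hinv
    exact ⟨h1, h2.mono hle, h3.imp fun _ => .mono hle, by omega, h5.mono hle⟩

/-- The two parts need each other: reading `K` relies on its entries being settled, and an entry
becomes settled by the invariant at `writeK`. -/
theorem pcInv_and_settled (hsel : SelectsMin sel) (i : ℕ) :
    (∀ p, τ.PCInv i p (τ.loc i p).pc) ∧ ∀ q, τ.Settled i ((τ.mem i).K q + 1) := by
  induction i with
  | zero =>
    constructor
    · intro p
      rw [τ.loc_zero]
      simp [PCInv, τ.cur_zero]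
    -- Initially `K` is `0`, and there is no index `m` with `1 ≤ m < 1`.
    · intro q m h1 h2
      rw [τ.mem_zero] at h2
      simp only at h2
      omega
  | succ i ih =>
    obtain ⟨ih, hK⟩ := ih
    have hle : i ≤ i + 1 := Nat.le_succ i
    rcases τ.step i with ⟨-, hm, hl, hc⟩ | ⟨q, op, hev, -, hm, hl, hc⟩ |
      ⟨q, op, a, L, hev, hcq, hmv, hl, hc⟩ | ⟨q, op, r, hev, hcq, hpc, hm, hl, hc⟩
    · refine ⟨fun p => ?_, fun q => ?_⟩
      · rw [hl]; exact (ih p).mono hle (by rw [hc])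
      · rw [hm]; exact (hK q).mono hle
    · refine ⟨fun p => ?_, fun q => ?_⟩
      · by_cases h : p = q
        · subst h; simp [hl, PCInv, hc]
        · rw [hl, update_of_ne h]; exact (ih p).mono hle (by rw [hc, update_of_ne h])
      · rw [hm]; exact (hK q).mono hle
    · refine ⟨fun p => ?_, fun p => ?_⟩
      · by_cases h : p = q
        · subst h
          rw [hl, update_self]
          exact (ih p).move hsel hK hev hcq (by rw [hc]) hmv
        · rw [hl, update_of_ne h]; exact (ih p).mono hle (by rw [hc])
      · rcases hmv.K_eq p with h | ⟨rfl, o, h⟩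
        · rw [h]; exact (hK p).mono hle
        · have := ih p
          rw [h] at this
          exact this.2.2.2.2.mono hle
    · refine ⟨fun p => ?_, fun q => ?_⟩
      · by_cases h : p = q
        · subst h; simp [hl, PCInv, hc]
        · rw [hl, update_of_ne h]; exact (ih p).mono hle (by rw [hc, update_of_ne h])
      · rw [hm]; exact (hK q).mono hle

end Trace

end UC

/-! ### Origins of announcements, bookings, decisions and commits; uniqueness of the second read -/

namespace UC

open Function

variable {n : ℕ} {Q O R : Type*} [DecidableEq O]

namespace Trace

variable {X : SeqObject Q O R} {lin : DepGraph O → List O} {sel : Fin n → O → ℕ → ABC O → O}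
  {τ : Trace n X lin sel}

theorem step_mem (τ : Trace n X lin sel) (i : ℕ) : τ.mem (i + 1) = τ.mem i ∨
    ∃ p a L, Move X lin sel p (τ.mem i) (τ.loc i p) a (τ.mem (i + 1)) L := by
  rcases τ.step i with ⟨-, hm, -⟩ | ⟨q, op, -, -, hm, -⟩ | ⟨q, op, a, L, -, -, hmv, -⟩ |
    ⟨q, op, r, -, -, -, hm, -⟩
  · exact Or.inl hm
  · exact Or.inl hm
  · exact Or.inr ⟨q, a, L, hmv⟩
  · exact Or.inl hm

theorem A_succ {i : ℕ} {o : O} (h : o ∈ τ.A (i + 1)) :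
    o ∈ τ.A i ∨ ∃ p, (τ.loc i p).pc = .addA o := by
  rw [mem_A] at h ⊢
  obtain ⟨q, hq⟩ := h
  rcases τ.step_mem i with hm | ⟨p, a, L, hmv⟩
  · rw [hm] at hq; exact Or.inl ⟨q, hq⟩
  · exact (hmv.mem_A (τ.mirrors i p) hq).imp (fun h => ⟨q, h⟩) fun h => ⟨p, h⟩

theorem bookedWith_succ {i : ℕ} {o : O} {b : ℕ} (h : τ.BookedWith (i + 1) o b) :
    τ.BookedWith i o b ∨ ∃ p, (τ.loc i p).pc = .addB o b := by
  obtain ⟨q, hq⟩ := h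
  rcases τ.step_mem i with hm | ⟨p, a, L, hmv⟩
  · rw [hm] at hq; exact Or.inl ⟨q, hq⟩
  · exact (hmv.mem_B (τ.mirrors i p) hq).imp (fun h => ⟨q, h⟩) fun h => ⟨p, h⟩

/-- At each step there is at most one process that commits an operation. -/
theorem dep_succ (τ : Trace n X lin sel) (i : ℕ) : ∃ pc : PC O R,
    (∀ o M, τ.Dep (i + 1) o M → τ.Dep i o M ∨
      (∃ r, pc = .addC o M r) ∨ ∃ op k, pc = .loopAddC op k o M) ∧
    (pc = .idle ∨ ∃ p, (τ.loc i p).pc = pc) := by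
  rcases τ.step_mem i with hm | ⟨p, a, L, hmv⟩
  · refine ⟨.idle, fun o M h => Or.inl ?_, Or.inl rfl⟩
    rwa [Dep, hm] at h
  · refine ⟨_, fun o M h => ?_, Or.inr ⟨p, rfl⟩⟩
    obtain ⟨q, hq⟩ := h
    exact (hmv.mem_C (τ.mirrors i p) hq).imp_left fun h => ⟨q, h⟩

theorem cons_succ {i k : ℕ} {w : O} (h : (τ.mem (i + 1)).cons k = some w) :
    (τ.mem i).cons k = some w ∨ ∃ p op, (τ.loc i p).pc = .propose op k w := by
  rcases τ.step_mem i with hm | ⟨p, a, L, hmv⟩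
  · rw [hm] at h; exact Or.inl h
  · exact (hmv.mem_cons h).imp_right fun h => ⟨p, h⟩

theorem cons_unique {i j k : ℕ} {w w' : O} (h : (τ.mem i).cons k = some w)
    (h' : (τ.mem j).cons k = some w') : w = w' := by
  have h1 := cons_mono (le_max_left i j) h
  have h2 := cons_mono (le_max_right i j) h'
  exact Option.some_injective _ (h1.symm.trans h2)

theorem pcInv (hsel : SelectsMin sel) (τ : Trace n X lin sel) {i : ℕ} {p : Fin n} {pc : PC O R}
    (h : (τ.loc i p).pc = pc) : τ.PCInv i p pc := h ▸ (pcInv_and_settled hsel i).1 p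

theorem exists_inv_of_cur {i : ℕ} {p : Fin n} {o : O} (h : τ.cur i p = some o) :
    ∃ j < i, τ.ev j = some (.inv p o) := by
  induction i with
  | zero => rw [τ.cur_zero] at h; simp at h
  | succ i ih =>
    have key : τ.cur i p = some o → ∃ j < i + 1, τ.ev j = some (.inv p o) := fun h => by
      obtain ⟨j, hj, h'⟩ := ih h
      exact ⟨j, by omega, h'⟩
    rcases τ.step i with ⟨-, -, -, hc⟩ | ⟨q, op, hev, -, -, -, hc⟩ |
      ⟨q, op, a, L, -, -, -, -, hc⟩ | ⟨q, op, r, -, -, -, -, -, hc⟩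
    · exact key (by rw [← hc]; exact h)
    · by_cases hq : p = q
      · subst hq
        rw [hc, update_self, Option.some.injEq] at h
        subst h
        exact ⟨i, by omega, hev⟩
      · exact key (by rw [hc, update_of_ne hq] at h; exact h)
    · exact key (by rw [← hc]; exact h)
    · by_cases hq : p = q
      · subst hq
        rw [hc, update_self] at h
        simp at h
      · exact key (by rw [hc, update_of_ne hq] at h; exact h)

theorem exists_inv_of_mem_A (hsel : SelectsMin sel) {i : ℕ} {o : O} (h : o ∈ τ.A i) :
    ∃ j < i, ∃ p, τ.ev j = some (.inv p o) := by
  induction i with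
  | zero => rw [mem_A] at h; simp [τ.mem_zero] at h
  | succ i ih =>
    rcases A_succ h with h | ⟨p, hp⟩
    · obtain ⟨j, hj, h'⟩ := ih h
      exact ⟨j, by omega, h'⟩
    · obtain ⟨j, hj, h'⟩ := exists_inv_of_cur (τ.pcInv hsel hp)
      exact ⟨j, by omega, p, h'⟩

theorem BookedWith.exists_card (hsel : SelectsMin sel) {i : ℕ} {o : O} {b : ℕ}
    (h : τ.BookedWith i o b) : ∃ j ≤ i, o ∈ τ.A j ∧ b = (τ.A j).card := by
  induction i with
  | zero => obtain ⟨p, h⟩ := h; simp [τ.mem_zero] at h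
  | succ i ih =>
    rcases bookedWith_succ h with h | ⟨p, hp⟩
    · obtain ⟨j, hj, h'⟩ := ih h
      exact ⟨j, by omega, h'⟩
    · obtain ⟨-, j, hj, h'⟩ := τ.pcInv hsel hp
      exact ⟨j, by omega, h'⟩

/-- The time `j` is that of the read before the winning proposal. -/
theorem exists_isMinBooked_of_cons (hsel : SelectsMin sel) {i k : ℕ} {w : O}
    (h : (τ.mem i).cons k = some w) :
    1 ≤ k ∧ ∃ j ≤ i, (τ.val j).IsMinBooked w ∧ τ.Settled j k := by
  induction i with
  | zero => simp [τ.mem_zero] at h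
  | succ i ih =>
    rcases cons_succ h with h | ⟨p, op, hp⟩
    · obtain ⟨h1, j, hj, h'⟩ := ih h
      exact ⟨h1, j, by omega, h'⟩
    · obtain ⟨-, -, -, h1, j, hj, h'⟩ := τ.pcInv hsel hp
      exact ⟨h1, j, by omega, h'⟩

/-- Both ways to commit write the vertex set of an earlier read in which the operation was still
uncommitted: the second read, or the read after a consensus decision. -/
theorem Dep.cases (hsel : SelectsMin sel) {i : ℕ} {o : O} {M : Finset O} (h : τ.Dep i o M) :
    (∃ t < i, τ.FastAt o t ∧ M = τ.V t) ∨
      ∃ k, ∃ j < i, (τ.mem j).cons k = some o ∧ o ∉ τ.V j ∧ M = τ.V j := by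
  induction i with
  | zero => obtain ⟨p, h⟩ := h; simp [τ.mem_zero] at h
  | succ i ih =>
    obtain ⟨pc, hpc, hp⟩ := τ.dep_succ i
    rcases hpc o M h with h | ⟨r, rfl⟩ | ⟨op, k, rfl⟩
    · rcases ih h with ⟨t, ht, h'⟩ | ⟨k, j, hj, h'⟩
      · exact Or.inl ⟨t, by omega, h'⟩
      · exact Or.inr ⟨k, j, by omega, h'⟩
    · simp only [reduceCtorEq, false_or] at hp
      obtain ⟨p, hp⟩ := hp
      obtain ⟨-, t, ht, h1, h2, -⟩ := τ.pcInv hsel hp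
      exact Or.inl ⟨t, by omega, h1, h2⟩
    · simp only [reduceCtorEq, false_or] at hp
      obtain ⟨p, hp⟩ := hp
      obtain ⟨-, -, -, -, -, j, hj, h'⟩ := τ.pcInv hsel hp
      exact Or.inr ⟨k, j, by omega, h'⟩

theorem FastAt.not_mem_V {o : O} {t : ℕ} (h : τ.FastAt o t) : o ∉ τ.V t := by
  obtain ⟨⟨p, -, -, h⟩, -⟩ := h
  exact h

theorem FastAt.mem_A (hsel : SelectsMin sel) {o : O} {t : ℕ} (h : τ.FastAt o t) : o ∈ τ.A t := by
  obtain ⟨⟨p, -, h, -⟩, -⟩ := h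
  exact (τ.pcInv hsel h).2.1

theorem FastAt.booked (hsel : SelectsMin sel) {o : O} {t : ℕ} (h : τ.FastAt o t) :
    ∃ b, τ.BookedWith t o b := by
  obtain ⟨⟨p, -, h, -⟩, -⟩ := h
  exact (τ.pcInv hsel h).2.2

theorem bookedWith_of_mem_B {i : ℕ} {o : O} {b : ℕ} (h : (o, b) ∈ (τ.val i).B) :
    τ.BookedWith i o b := ABCSnapshot.exists_mem_of_mem_merge_B h

/-- A vertex might occur only as a predecessor, but predecessors were vertices at a strictly earlier
time; the descent ends at a pair committing the operation itself. -/
theorem exists_dep (hsel : SelectsMin sel) {i : ℕ} {o : O} (h : o ∈ τ.V i) :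
    ∃ M, τ.Dep i o M := by
  induction i using Nat.strong_induction_on with
  | _ i ih =>
  obtain ⟨a, M, hd, rfl | ho⟩ := mem_V.1 h
  · exact ⟨M, hd⟩
  · rcases hd.cases hsel with ⟨t, ht, -, rfl⟩ | ⟨k, t, ht, -, -, rfl⟩ <;>
    · obtain ⟨M, hM⟩ := ih t ht ho
      exact ⟨M, hM.mono ht.le⟩

theorem Dep.mem_V {i : ℕ} {o : O} {M : Finset O} (h : τ.Dep i o M) : o ∈ τ.V i :=
  Trace.mem_V.2 ⟨o, M, h, Or.inl rfl⟩

theorem V_subset_A (hsel : SelectsMin sel) (i : ℕ) : τ.V i ⊆ τ.A i := by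
  intro o ho
  obtain ⟨M, hM⟩ := exists_dep hsel ho
  rcases hM.cases hsel with ⟨t, ht, hf, -⟩ | ⟨k, j, hj, hk, -⟩
  · exact A_mono ht.le (hf.mem_A hsel)
  · obtain ⟨-, j0, hj0, ⟨-, b, hb, -⟩, -⟩ := exists_isMinBooked_of_cons hsel hk
    obtain ⟨j1, hj1, h1, -⟩ := (bookedWith_of_mem_B hb).exists_card hsel
    exact A_mono (by omega) h1

theorem V_zero (τ : Trace n X lin sel) : τ.V 0 = ∅ := by
  ext o
  rw [Trace.mem_V]
  simp [Dep, τ.mem_zero]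

/-- An operation that is announced after a conflict-free operation `b` has taken its decision is
not decided by consensus before `b` is committed. -/
theorem FastAt.mem_V_of_cons (hsel : SelectsMin sel) {a b : O} {t j k : ℕ} (hb : τ.FastAt b t)
    (hk : (τ.mem j).cons k = some a) (ha : a ∉ τ.A t) : b ∈ τ.V j := by
  obtain ⟨-, j0, hj0, ⟨hav, b1, hb1, hmin⟩, -⟩ := exists_isMinBooked_of_cons hsel hk
  obtain ⟨j1, hj1, h1, rfl⟩ := (bookedWith_of_mem_B hb1).exists_card hsel
  obtain ⟨b2, hb2⟩ := hb.booked hsel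
  obtain ⟨j2, hj2, h2, rfl⟩ := hb2.exists_card hsel
  have htj : t < j1 := by
    by_contra h
    exact ha (A_mono (by omega) h1)
  -- The announced set only grows, and `a` separates the set counted for `a` from the one counted
  -- for `b`, so `b` has the smaller booking number.
  have hcard : (τ.A j2).card < (τ.A j1).card := by
    refine Finset.card_lt_card ⟨A_mono (by omega), fun h => ha (A_mono hj2 (h h1))⟩
  by_contra hbV
  obtain ⟨p, hp⟩ := hb2.mono (show t ≤ j0 by omega)
  obtain ⟨b', hb', hm⟩ := ABCSnapshot.exists_mem_merge_B hp
  have := hmin (b, b') hm (fun h => hbV (V_mono hj0 h))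
  simp only at this
  omega

theorem SecondReadAt.ev_cur {p : Fin n} {o : O} {t : ℕ} (hsel : SelectsMin sel)
    (h : τ.SecondReadAt p o t) : τ.cur t p = some o := (τ.pcInv hsel h.2.1).1

theorem inv_unique' {i j : ℕ} {p p' : Fin n} {o : O} (h : τ.ev i = some (.inv p o))
    (h' : τ.ev j = some (.inv p' o)) : i = j ∧ p = p' := by
  have hij := τ.inv_unique i j p p' o h h'
  subst hij
  rw [h] at h'
  simp only [Option.some.injEq, Event.inv.injEq, and_true] at h'
  exact ⟨rfl, h'⟩

theorem eq_of_cur {i j : ℕ} {p q : Fin n} {o : O} (h : τ.cur i p = some o)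
    (h' : τ.cur j q = some o) : p = q := by
  obtain ⟨_, _, h1⟩ := exists_inv_of_cur h
  obtain ⟨_, _, h2⟩ := exists_inv_of_cur h'
  exact (inv_unique' h1 h2).2

/-- The part of `publish(o)` before the decision at the second read. -/
def Early (o : O) (pc : PC O R) : Prop :=
  pc = .addA o ∨ pc = .read1 o ∨ (∃ b, pc = .addB o b) ∨ pc = .read2 o

theorem Early.cur_eq (hsel : SelectsMin sel) {i : ℕ} {p : Fin n} {o : O}
    (h : Early o (τ.loc i p).pc) : τ.cur i p = some o := by
  rcases h with h | h | ⟨b, h⟩ | h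
  · exact τ.pcInv hsel h
  · exact (τ.pcInv hsel h).1
  · exact (τ.pcInv hsel h).1
  · exact (τ.pcInv hsel h).1

theorem Early.of_move {p : Fin n} {m m' : Memory n O} {L L' : Local O R} {a : Access O} {o : O}
    (h : Move X lin sel p m L a m' L') (h' : Early o L'.pc) :
    Early o L.pc ∧ L.pc ≠ .read2 o := by
  cases h <;> simp only [Early, reduceCtorEq, false_or, or_false, PC.read1.injEq, PC.addB.injEq,
    exists_const, exists_and_left, exists_eq', and_true, PC.read2.injEq] at h' ⊢
  case read2 m RA RB RC op =>
    exfalso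
    unfold afterRead2 at h'
    split_ifs at h' <;> simp at h'
  all_goals simp [h']

/-- The program counter never returns to the early part within one execution, and each operation is
invoked once. Thus decision times are unique. -/
theorem Early.not_secondReadAt (hsel : SelectsMin sel) {i : ℕ} {p : Fin n} {o : O}
    (h : Early o (τ.loc i p).pc) : ∀ t < i, ∀ q, ¬ τ.SecondReadAt q o t := by
  induction i with
  | zero => simp
  | succ i ih =>
    have hcur := h.cur_eq hsel
    have old : Early o (τ.loc i p).pc → (τ.loc i p).pc ≠ .read2 o →
        ∀ t < i + 1, ∀ q, ¬ τ.SecondReadAt q o t := by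
      intro he hne t ht q hq
      rcases Nat.lt_succ_iff_lt_or_eq.1 ht with ht | rfl
      · exact ih he t ht q hq
      · have := eq_of_cur (hq.ev_cur hsel) hcur
        subst this
        exact hne hq.2.1
    have stay : τ.loc (i + 1) p = τ.loc i p → (∀ q, ¬ τ.SecondReadAt q o i) →
        ∀ t < i + 1, ∀ q, ¬ τ.SecondReadAt q o t := by
      intro hl hno t ht q hq
      rw [hl] at h
      rcases Nat.lt_succ_iff_lt_or_eq.1 ht with ht | rfl
      · exact ih h t ht q hq
      · exact hno q hq
    rcases τ.step i with ⟨hev, -, hl, -⟩ | ⟨q, op, hev, -, -, hl, hc⟩ |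
      ⟨q, op, a, L, hev, hcq, hmv, hl, -⟩ | ⟨q, op, r, hev, -, -, -, hl, -⟩
    · exact stay (by rw [hl]) fun q hq => by simp [hq.1] at hev
    · by_cases hq : p = q
      · subst hq
        rw [hc, update_self, Option.some.injEq] at hcur
        subst hcur
        intro t ht q hq
        obtain ⟨j, hj, hj'⟩ := exists_inv_of_cur (hq.ev_cur hsel)
        have := (inv_unique' hev hj').1
        omega
      · exact stay (by rw [hl, update_of_ne hq]) fun q hq => by simp [hq.1] at hev
    · by_cases hq : p = q
      · subst hq
        rw [hl, update_self] at h
        obtain ⟨h1, h2⟩ := Early.of_move hmv h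
        exact old h1 h2
      · refine stay (by rw [hl, update_of_ne hq]) fun q' hq' => ?_
        have h1 := eq_of_cur (hq'.ev_cur hsel) hcur
        have h2 := hq'.1
        rw [hev] at h2
        simp only [Option.some.injEq, Event.step.injEq] at h2
        exact hq (h1.symm.trans h2.1.symm)
    · by_cases hq : p = q
      · subst hq
        rw [hl, update_self] at h
        simp [Early] at h
      · exact stay (by rw [hl, update_of_ne hq]) fun q hq => by simp [hq.1] at hev

theorem FastAt.unique (hsel : SelectsMin sel) {o : O} {t t' : ℕ} (h : τ.FastAt o t)
    (h' : τ.FastAt o t') : t = t' := by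
  obtain ⟨⟨p, hp⟩, -⟩ := h
  obtain ⟨⟨p', hp'⟩, -⟩ := h'
  rcases lt_trichotomy t t' with hlt | rfl | hlt
  · exact absurd hp
      (Early.not_secondReadAt hsel (Or.inr (Or.inr (Or.inr hp'.2.1))) t hlt p)
  · rfl
  · exact absurd hp'
      (Early.not_secondReadAt hsel (Or.inr (Or.inr (Or.inr hp.2.1))) t' hlt p')

end Trace

end UC

/-! ### Commit order, and its equivalence with the topological orders -/

namespace UC

open Function

variable {n : ℕ} {Q O R : Type*} [DecidableEq O]

namespace Trace

variable {X : SeqObject Q O R} {lin : DepGraph O → List O} {sel : Fin n → O → ℕ → ABC O → O}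
  (τ : Trace n X lin sel)

/-- The time at which `o` is committed. -/
noncomputable def com (o : O) : ℕ := sInf {i | o ∈ τ.V i}

/-- The time at which `o` is announced. -/
noncomputable def ann (o : O) : ℕ := sInf {i | o ∈ τ.A i}

/-- The operations committed until time `i`, in the order of their commits. -/
noncomputable def commits : ℕ → List O
  | 0 => []
  | i + 1 => commits i ++ (τ.V (i + 1) \ τ.V i).toList

/-- The operations committed until time `T`, where those operations count as conflict-free whose
conflict-free commit has been written until then. -/
noncomputable def commitData (T : ℕ) : CommitData O where
  com := τ.com
  ann := τ.ann
  Fast x t := τ.FastAt x t ∧ τ.Dep T x (τ.V t)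
  order := τ.commits T

variable {τ}

/-- Some commit has to be assumed, as `com` is the default `0` on operations that are never
committed. -/
theorem com_le_iff {o : O} {i T : ℕ} (h : o ∈ τ.V T) : τ.com o ≤ i ↔ o ∈ τ.V i :=
  ⟨fun hi => V_mono hi (Nat.sInf_mem (s := {i | o ∈ τ.V i}) ⟨T, h⟩), fun hi => Nat.sInf_le hi⟩

theorem ann_le_iff {o : O} {i T : ℕ} (h : o ∈ τ.A T) : τ.ann o ≤ i ↔ o ∈ τ.A i :=
  ⟨fun hi => A_mono hi (Nat.sInf_mem (s := {i | o ∈ τ.A i}) ⟨T, h⟩), fun hi => Nat.sInf_le hi⟩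

theorem mem_commits {i : ℕ} {o : O} : o ∈ τ.commits i ↔ o ∈ τ.V i := by
  induction i with
  | zero => simp [commits, V_zero]
  | succ i ih =>
    simp only [commits, List.mem_append, ih, Finset.mem_toList, Finset.mem_sdiff]
    have := @V_mono _ _ _ _ _ _ _ _ τ i (i + 1) (Nat.le_succ i) o
    tauto

/-- A new vertex is the target of a newly written pair, and a step writes at most one pair. So the
arbitrary order of `toList` in `commits` is harmless. -/
theorem eq_of_mem_sdiff_V (hsel : SelectsMin sel) {i : ℕ} {a b : O}
    (ha : a ∈ τ.V (i + 1) \ τ.V i) (hb : b ∈ τ.V (i + 1) \ τ.V i) : a = b := by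
  rw [Finset.mem_sdiff] at ha hb
  obtain ⟨M, hM⟩ := exists_dep hsel ha.1
  obtain ⟨N, hN⟩ := exists_dep hsel hb.1
  obtain ⟨pc, hpc, -⟩ := τ.dep_succ i
  have h1 := (hpc a M hM).resolve_left fun h => ha.2 h.mem_V
  have h2 := (hpc b N hN).resolve_left fun h => hb.2 h.mem_V
  rcases h1 with ⟨r, rfl⟩ | ⟨op, k, rfl⟩ <;> simp at h2 <;> exact h2.1

theorem commits_sorted (hsel : SelectsMin sel) (i : ℕ) :
    (τ.commits i).Pairwise (fun a b => τ.com a < τ.com b) := by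
  induction i with
  | zero => simp [commits]
  | succ i ih =>
    refine List.pairwise_append.2 ⟨ih, ?_, fun a ha b hb => ?_⟩
    · refine (Finset.nodup_toList _).imp_of_mem fun {a b} ha hb hne => ?_
      rw [Finset.mem_toList] at ha hb
      exact absurd (eq_of_mem_sdiff_V hsel ha hb) hne
    · rw [mem_commits] at ha
      rw [Finset.mem_toList, Finset.mem_sdiff] at hb
      have h1 := (com_le_iff ha).2 ha
      have h2 := mt (com_le_iff hb.1).1 hb.2
      omega

theorem commits_prefix {i j : ℕ} (h : i ≤ j) :
    ∃ u, τ.commits j = τ.commits i ++ u ∧ ∀ o ∈ u, o ∉ τ.V i := by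
  induction h with
  | refl => exact ⟨[], by simp, by simp⟩
  | step h ih =>
    rename_i j
    obtain ⟨u, hu, hV⟩ := ih
    refine ⟨u ++ (τ.V (j + 1) \ τ.V j).toList, by rw [commits, hu, List.append_assoc], ?_⟩
    intro o ho
    rcases List.mem_append.1 ho with ho | ho
    · exact hV o ho
    · rw [Finset.mem_toList, Finset.mem_sdiff] at ho
      exact fun h' => ho.2 (V_mono h h')

theorem commits_nodup (hsel : SelectsMin sel) (i : ℕ) : (τ.commits i).Nodup :=
  (commits_sorted hsel i).imp fun {a b} hab => by rintro rfl; omega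

theorem filter_commits {t T : ℕ} (h : t ≤ T) :
    (τ.commits T).filter (fun y => τ.com y ≤ t) = τ.commits t := by
  obtain ⟨u, hu, hV⟩ := τ.commits_prefix h
  have hT : ∀ y ∈ τ.commits T, (τ.com y ≤ t ↔ y ∈ τ.V t) := fun y hy =>
    com_le_iff (mem_commits.1 hy)
  rw [hu] at hT ⊢
  rw [List.filter_append, List.filter_eq_self.2, List.filter_eq_nil_iff.2, List.append_nil]
  · intro o ho
    simpa [hT o (by simp [ho])] using hV o ho
  · intro o ho
    simpa [hT o (by simp [ho])] using mem_commits.1 ho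

theorem result_commits_mono {i j : ℕ} (h : i ≤ j) {o : O} (ho : o ∈ τ.V i) :
    X.result (τ.commits j) o = X.result (τ.commits i) o := by
  obtain ⟨u, hu, -⟩ := τ.commits_prefix h
  rw [hu, X.result_append_of_mem (mem_commits.2 ho)]

theorem exists_time_of_edge {i : ℕ} {a b : O} (h : (τ.val i).C.Edge a b) (hsel : SelectsMin sel) :
    ∃ j < i, a ∈ τ.V j ∧ b ∉ τ.V j := by
  obtain ⟨M, hM, ha⟩ := edge_iff.1 h
  rcases hM.cases hsel with ⟨t, ht, hf, rfl⟩ | ⟨k, t, ht, -, hb, rfl⟩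
  · exact ⟨t, ht, ha, hf.not_mem_V⟩
  · exact ⟨t, ht, ha, hb⟩

/-- The predecessors of `b` were read while `b` was uncommitted. Commit time is therefore a rank
function, which gives acyclicity. -/
theorem com_lt_of_edge (hsel : SelectsMin sel) {i : ℕ} {a b : O} (h : (τ.val i).C.Edge a b) :
    τ.com a < τ.com b := by
  obtain ⟨M, hM, -⟩ := edge_iff.1 h
  obtain ⟨j, hj, ha, hb⟩ := exists_time_of_edge h hsel
  have h1 := (com_le_iff ha).2 ha
  have h2 := mt (com_le_iff hM.mem_V).1 hb
  omega

theorem acyclic (hsel : SelectsMin sel) (τ : Trace n X lin sel) (i : ℕ) :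
    (τ.val i).C.Acyclic := by
  have key : ∀ a b, Relation.TransGen (τ.val i).C.Edge a b → τ.com a < τ.com b := by
    intro a b h
    induction h with
    | single h => exact com_lt_of_edge hsel h
    | tail _ h ih => exact ih.trans (com_lt_of_edge hsel h)
  exact fun a h => lt_irrefl _ (key a a h)

theorem fast_lt {o : O} {t T : ℕ} (ho : o ∈ τ.V T) (h : τ.FastAt o t) : t < τ.com o := by
  by_contra hlt
  exact h.not_mem_V ((com_le_iff ho).1 (not_lt.1 hlt))

theorem ann_le_of_fast (hsel : SelectsMin sel) {o : O} {t : ℕ} (h : τ.FastAt o t) :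
    τ.ann o ≤ t := Nat.sInf_le (h.mem_A hsel)

/-- A slow `a` was chosen by consensus and was still uncommitted at the read after the decision,
when `b` was already committed by `FastAt.mem_V_of_cons`. -/
theorem com_lt_of_slow (hsel : SelectsMin sel) {T t : ℕ} {a b : O} (ha : a ∈ τ.V T)
    (hb : τ.FastAt b t) (hslow : ∀ t', ¬ (τ.FastAt a t' ∧ τ.Dep T a (τ.V t')))
    (hta : t < τ.ann a) : τ.com b < τ.com a := by
  obtain ⟨M, hM⟩ := exists_dep hsel ha
  rcases hM.cases hsel with ⟨t', -, hf, rfl⟩ | ⟨k, j, hj, hk, hn, -⟩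
  · exact absurd ⟨hf, hM⟩ (hslow t')
  · have haA : a ∉ τ.A t := fun h => by
      have : τ.ann a ≤ t := Nat.sInf_le h
      omega
    have hbV := hb.mem_V_of_cons hsel hk haA
    have h1 := (com_le_iff hbV).2 hbV
    have h2 := mt (com_le_iff ha).1 hn
    omega

/-- The required order is part of the dependency graph. -/
theorem edge_of_req (hsel : SelectsMin sel) {T : ℕ} {a b : O} (ha : a ∈ τ.V T) (hb : b ∈ τ.V T)
    (h : (τ.commitData T).Req a b) : (τ.val T).C.Edge a b := by
  rw [edge_iff]
  by_contra hno
  push Not at hno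
  obtain ⟨hlt, h⟩ := h
  have hfb : ∀ t, τ.FastAt b t → τ.Dep T b (τ.V t) → t < τ.com a := fun t _ hd => by
    by_contra h'
    exact hno _ hd ((com_le_iff ha).1 (not_lt.1 h'))
  have h : ¬ (τ.commitData T).Indep a b := h.resolve_left fun ⟨t, ⟨h1, h2⟩, h3⟩ => by
    have := hfb t h1 h2
    change τ.com a ≤ t at h3
    omega
  change τ.com a < τ.com b at hlt
  refine h ?_
  by_cases hb' : ∃ t, τ.FastAt b t ∧ τ.Dep T b (τ.V t)
  · obtain ⟨t, hbt, hbd⟩ := hb'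
    by_cases hat : τ.ann a ≤ t
    · exact Or.inr ⟨t, ⟨hbt, hbd⟩, hat, hfb t hbt hbd⟩
    -- Here `b` decided before `a` was announced: a fast `a` decided later and saw `b` announced,
    -- while a slow `a` would have been committed after `b`.
    · by_cases ha' : ∃ t', τ.FastAt a t' ∧ τ.Dep T a (τ.V t')
      · obtain ⟨t', hat', had⟩ := ha'
        have h1 := ann_le_of_fast hsel hat'
        have h2 := ann_le_of_fast hsel hbt
        exact Or.inl ⟨t', ⟨hat', had⟩, by change τ.ann b ≤ t'; omega⟩
      · push Not at ha'
        have := com_lt_of_slow hsel ha hbt (fun t' h' => ha' t' h'.1 h'.2) (not_le.1 hat)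
        omega
  · obtain ⟨M, hM⟩ := exists_dep hsel hb
    have hMa := hno M hM
    rcases hM.cases hsel with ⟨t', -, hf, rfl⟩ | ⟨k, j, hj, hk, hn, rfl⟩
    · exact absurd ⟨t', hf, hM⟩ hb'
    · by_cases ha' : ∃ t', τ.FastAt a t' ∧ τ.Dep T a (τ.V t')
      · obtain ⟨t, hat, had⟩ := ha'
        refine Or.inl ⟨t, ⟨hat, had⟩, ?_⟩
        change τ.ann b ≤ t
        by_contra hbt
        refine hMa (hat.mem_V_of_cons hsel hk fun h' => hbt (Nat.sInf_le h'))
      · exfalso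
        obtain ⟨N, hN⟩ := exists_dep hsel ha
        rcases hN.cases hsel with ⟨t', -, hf, rfl⟩ | ⟨m, i, hi, hm, hn', rfl⟩
        · exact ha' ⟨t', hf, hN⟩
        -- Both were decided by consensus, so their indices are compared: a smaller index for `a`
        -- puts `a` among the predecessors of `b`, and a larger one means that `b` was committed
        -- first.
        · obtain ⟨hk1, j0, hj0, -, hs⟩ := exists_isMinBooked_of_cons hsel hk
          obtain ⟨hm1, i0, hi0, -, hs'⟩ := exists_isMinBooked_of_cons hsel hm
          rcases lt_trichotomy m k with hmk | rfl | hmk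
          · obtain ⟨w, hw, hwV⟩ := hs m hm1 hmk
            rw [cons_unique hw hm] at hwV
            exact hMa (V_mono hj0 hwV)
          · rw [cons_unique hm hk] at hlt
            exact lt_irrefl _ hlt
          · obtain ⟨w, hw, hwV⟩ := hs' k hk1 hmk
            rw [cons_unique hw hk] at hwV
            have h1 := (com_le_iff hb).2 (V_mono hi0 hwV)
            have h2 := mt (com_le_iff ha).1 hn'
            omega

/-- The topological sorting procedure. -/
def Sorts (lin : DepGraph O → List O) : Prop :=
  ∀ C : DepGraph O, C.Acyclic → C.IsTopologicalOrdering (lin C)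

theorem mem_lin (hlin : Sorts lin) (hsel : SelectsMin sel) {T : ℕ} {o : O} :
    o ∈ lin (τ.val T).C ↔ o ∈ τ.V T := (hlin _ (acyclic hsel τ T)).mem_iff o

theorem good_lin (hlin : Sorts lin) (hsel : SelectsMin sel) (τ : Trace n X lin sel) (T : ℕ) :
    (τ.commitData T).Good (lin (τ.val T).C) := by
  have ht := hlin _ (acyclic hsel τ T)
  refine ⟨fun a ha => mem_commits.2 ((mem_lin hlin hsel).1 ha), ht.nodup,
    fun _ _ _ _ y hy _ => (mem_lin hlin hsel).2 (mem_commits.1 hy), ?_⟩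
  rw [List.pairwise_iff_getElem]
  intro i j hi hj hij hr
  have he := edge_of_req hsel ((mem_lin hlin hsel).1 (List.getElem_mem hj))
    ((mem_lin hlin hsel).1 (List.getElem_mem hi)) hr
  have := ht.edge _ _ he
  rw [ht.nodup.idxOf_getElem, ht.nodup.idxOf_getElem] at this
  omega

theorem lin_perm_commits (hlin : Sorts lin) (hsel : SelectsMin sel) (τ : Trace n X lin sel)
    (T : ℕ) : (lin (τ.val T).C).Perm (τ.commits T) :=
  (List.perm_ext_iff_of_nodup (hlin _ (acyclic hsel τ T)).nodup (commits_nodup hsel T)).2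
    fun _ => (mem_lin hlin hsel).trans mem_commits.symm

/-- The test at time `t` was made in the state of `lin`, whereas confluence needs it after `commits
t`; the hypothesis at `t < T` translates between them. -/
theorem admissible_of_lin_equiv (hsel : SelectsMin sel) {T : ℕ}
    (ih : ∀ t < T, X.OrdEquiv (lin (τ.val t).C) (τ.commits t)) :
    (τ.commitData T).Admissible X where
  sorted := commits_sorted hsel T
  fast_lt x hx t ht := fast_lt (mem_commits.1 hx) ht.1
  slow a ha b hb t hbt hslow hta := com_lt_of_slow hsel (mem_commits.1 ha) hbt.1 hslow hta
  comm x hx t ht s hs hsub := by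
    change X.CommutesSeq x ((τ.commits T).filter fun y => τ.com y ≤ t) s
    have hxT := mem_commits.1 hx
    have htT : t < T := (fast_lt hxT ht.1).trans_le ((com_le_iff hxT).2 hxT)
    rw [filter_commits htT.le]
    have hc : X.CommutesSeq x (lin (τ.val t).C) s := by
      refine ht.1.2 s.toFinset ?_ s hs (by simp)
      intro y hy
      obtain ⟨h1, h2, h3, h4⟩ := hsub y (by simpa using hy)
      have hyT := mem_commits.1 h1
      simp only [Finset.mem_sdiff, Finset.mem_singleton]
      exact ⟨⟨(ann_le_iff (V_subset_A hsel T hyT)).1 h3,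
        fun h => absurd ((com_le_iff hyT).2 h) (not_le.2 h4)⟩, h2⟩
    have e := ih t htT
    have e1 := (e.append_right s).append_right [x]
    have e2 := (e.append_right [x]).append_right s
    exact e1.symm.trans (SeqObject.OrdEquiv.trans hc e2)

/-- Strong induction on time: the commutations used at `T` were tested earlier. Both lists are good
orderings of the same set. -/
theorem lin_equiv (hlin : Sorts lin) (hsel : SelectsMin sel) (τ : Trace n X lin sel) (T : ℕ) :
    X.OrdEquiv (lin (τ.val T).C) (τ.commits T) := by
  induction T using Nat.strong_induction_on with
  | _ T ih =>
  have had := admissible_of_lin_equiv hsel ih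
  exact had.ordEquiv (fun x _ t ht => ann_le_of_fast hsel ht.1) (good_lin hlin hsel τ T)
    had.good_order (lin_perm_commits hlin hsel τ T)

/-- A conflict-free operation can be moved to the place of its decision. -/
theorem FastAt.result_eq (hlin : Sorts lin) (hsel : SelectsMin sel) {o : O} {t T : ℕ}
    (h : τ.FastAt o t) (hd : τ.Dep T o (τ.V t)) :
    X.result (τ.commits T) o = X.result (lin (τ.val t).C ++ [o]) o := by
  have had := admissible_of_lin_equiv (T := T) hsel fun t _ => lin_equiv hlin hsel τ t
  have hoT : o ∈ τ.V T := hd.mem_V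
  have htT : t < T := (fast_lt hoT h).trans_le ((com_le_iff hoT).2 hoT)
  obtain ⟨u, hu, huV⟩ := τ.commits_prefix htT.le
  have hou : o ∈ u := by
    have h1 := mem_commits.2 hoT
    rw [hu, List.mem_append] at h1
    exact h1.resolve_left fun h' => h.not_mem_V (mem_commits.1 h')
  have hperm : (τ.commits t ++ o :: u.erase o).Perm (τ.commits T) := by
    rw [hu]
    exact (List.perm_cons_erase hou).symm.append_left _
  have hnd := hperm.nodup_iff.2 (commits_nodup hsel T)
  have hsort := commits_sorted (τ := τ) hsel T
  rw [hu, List.pairwise_append] at hsort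
  have hmT : ∀ y ∈ u, y ∈ τ.V T := fun y hy => mem_commits.1 (by rw [hu]; simp [hy])
  -- Nothing committed after `t` is required before `o`, so placing `o` directly after its tested
  -- state is also good, and confluence compares this list with the commit order.
  have hgood : (τ.commitData T).Good (τ.commits t ++ o :: u.erase o) := by
    refine ⟨fun a ha => hperm.mem_iff.1 ha, hnd,
      fun _ _ _ _ y hy _ => hperm.mem_iff.2 hy, ?_⟩
    refine List.pairwise_append.2 ⟨?_, List.pairwise_cons.2 ⟨?_, ?_⟩, ?_⟩
    · exact hsort.1.imp fun {a b} hab hr => absurd hr.1 (not_lt.2 hab.le)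
    · intro b hb hr
      have hbu : b ∈ u := List.mem_of_mem_erase hb
      have hbt : t < τ.com b := by
        by_contra h'
        exact huV b hbu ((com_le_iff (hmT b hbu)).1 (not_lt.1 h'))
      obtain ⟨hlt, hr⟩ := hr
      change τ.com b < τ.com o at hlt
      rcases hr with ⟨t', ⟨ht', -⟩, hle⟩ | hr
      · rw [ht'.unique hsel h] at hle
        exact absurd hle (not_le.2 hbt)
      · refine hr ?_
        by_cases hann : τ.ann b ≤ t
        · exact Or.inr ⟨t, ⟨h, hd⟩, hann, hbt⟩
        · by_cases hb' : ∃ t', τ.FastAt b t' ∧ τ.Dep T b (τ.V t')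
          · obtain ⟨t', hft', hdt'⟩ := hb'
            have h1 := ann_le_of_fast hsel hft'
            have h2 := ann_le_of_fast hsel h
            exact Or.inl ⟨t', ⟨hft', hdt'⟩, by change τ.ann o ≤ t'; omega⟩
          · push Not at hb'
            have := com_lt_of_slow hsel (hmT b hbu) h (fun t' h' => hb' t' h'.1 h'.2)
              (not_le.1 hann)
            omega
    · exact (hsort.2.1.sublist List.erase_sublist).imp fun {a b} hab hr =>
        absurd hr.1 (not_lt.2 hab.le)
    · intro a ha b hb hr
      have hbu : b ∈ u := by
        rcases List.mem_cons.1 hb with rfl | hb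
        · exact hou
        · exact List.mem_of_mem_erase hb
      exact absurd hr.1 (not_lt.2 (hsort.2.2 a ha b hbu).le)
  have e := had.ordEquiv (fun x _ t ht => ann_le_of_fast hsel ht.1) had.good_order hgood
    hperm.symm
  have hr := e.2.2 o (mem_commits.2 hoT)
  change X.result (τ.commits T) o = _ at hr
  have e' := (lin_equiv hlin hsel τ t).append_right [o]
  rw [hr, e'.2.2 o (by simp), ← X.result_append_of_mem (s := τ.commits t ++ [o]) (by simp)
    (u.erase o)]
  simp

theorem Responds.eq_result (hlin : Sorts lin) (hsel : SelectsMin sel) {i : ℕ} {o : O} {r : R}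
    (h : τ.Responds i o r) : o ∈ τ.V i ∧ r = X.result (τ.commits i) o := by
  rcases h with ⟨j, hj, ho, rfl⟩ | ⟨t, ht, hf, hd, rfl⟩
  · refine ⟨V_mono hj ho, ?_⟩
    rw [result_commits_mono hj ho]
    exact (lin_equiv hlin hsel τ j).2.2 o ((mem_lin hlin hsel).2 ho)
  · exact ⟨hd.mem_V, (hf.result_eq hlin hsel hd).symm⟩

theorem res_eq_result (hlin : Sorts lin) (hsel : SelectsMin sel) {i : ℕ} {p : Fin n} {o : O}
    {r : R} (h : τ.ev i = some (.res p o r)) :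
    τ.cur i p = some o ∧ o ∈ τ.V i ∧ r = X.result (τ.commits i) o := by
  rcases τ.step i with ⟨hev, -⟩ | ⟨q, op, hev, -⟩ | ⟨q, op, a, L, hev, -⟩ |
    ⟨q, op, r, hev, hcq, hpc, -⟩
  · simp [hev] at h
  · simp [hev] at h
  · simp [hev] at h
  · rw [hev] at h
    simp only [Option.some.injEq, Event.res.injEq] at h
    obtain ⟨rfl, rfl, rfl⟩ := h
    obtain ⟨o, ho, hr⟩ := τ.pcInv hsel hpc
    rw [hcq, Option.some.injEq] at ho
    subst ho
    exact ⟨hcq, hr.eq_result hlin hsel⟩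

/-- If `a` is committed before `b` is announced, then `a` has to stand before `b`. -/
theorem req_of_lt (hsel : SelectsMin sel) {T i : ℕ} {a b : O} (ha : a ∈ τ.V i) (hb : b ∈ τ.V T)
    (hbi : b ∉ τ.A i) : (τ.commitData T).Req a b := by
  have h1 : τ.com a ≤ i := (com_le_iff ha).2 ha
  have h2 : i < τ.ann b := by
    by_contra h'
    exact hbi ((ann_le_iff (V_subset_A hsel T hb)).1 (not_lt.1 h'))
  have h3 : i < τ.com b := by
    by_contra h'
    exact hbi (V_subset_A hsel i ((com_le_iff hb).1 (not_lt.1 h')))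
  refine ⟨h1.trans_lt h3, Or.inr ?_⟩
  rintro (⟨t, ⟨hf, -⟩, ht⟩ | ⟨t, ⟨hf, -⟩, -, ht⟩)
  · have := fast_lt ha hf
    change τ.ann b ≤ t at ht
    omega
  · have := ann_le_of_fast hsel hf
    change t < τ.com a at ht
    omega

end Trace

end UC

/-! ### Finite or infinite sequences -/

theorem get?_seqFilterMap {α β : Type*} (f : α → Option β) (s : Stream'.Seq α) (k : ℕ) (b : β) :
    (seqFilterMap f s).get? k = some b ↔ ∃ i, (s.get? i).bind f = some b ∧
      (open Classical in Nat.count (fun j => ((s.get? j).bind f).isSome) i) = k := by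
  classical
  change ite _ _ _ = _ ↔ _
  constructor
  · intro h
    split_ifs at h with hk
    obtain ⟨i, hi, hik⟩ := hk
    subst hik
    rw [Nat.nth_count hi] at h
    exact ⟨i, h, by congr⟩
  · rintro ⟨i, hi, hik⟩
    have hs : ((s.get? i).bind f).isSome := by simp [hi]
    have hik' : Nat.count (fun j => ((s.get? j).bind f).isSome) i = k := by rw [← hik]
    subst hik'
    rw [if_pos ⟨i, hs, rfl⟩, ← hi]
    congr 1
    convert congrArg s.get? (Nat.nth_count (p := fun j => ((s.get? j).bind f).isSome) hs)

/-- The prefix of `s` of length at most `n`. -/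
def seqTake {α : Type*} (n : ℕ) (s : Stream'.Seq α) : Stream'.Seq α :=
  ⟨fun k => if k < n then s.get? k else none, by
    intro k hk
    change ite _ _ _ = _ at hk
    change ite _ _ _ = _
    split_ifs at hk ⊢ with h1 h2
    · exact s.le_stable (Nat.le_succ k) hk
    · omega
    · rfl
    · rfl⟩

theorem get?_seqTake {α : Type*} {n : ℕ} {s : Stream'.Seq α} {k : ℕ} {a : α} :
    (seqTake n s).get? k = some a ↔ k < n ∧ s.get? k = some a := by
  change ite _ _ _ = _ ↔ _
  split_ifs with h <;> simp [h]

open Classical in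
/-- The limit of a growing sequence of lists. -/
noncomputable def seqLimit {α : Type*} (l : ℕ → List α) : Stream'.Seq α :=
  ⟨fun k => if h : ∃ i, k < (l i).length then (l h.choose)[k]? else none, by
    intro k hk
    change dite _ _ _ = _ at hk
    change dite _ _ _ = _
    refine dif_neg ?_
    rintro ⟨i, hi⟩
    have h1 : ∃ i, k < (l i).length := ⟨i, by omega⟩
    rw [dif_pos h1, List.getElem?_eq_none_iff] at hk
    exact absurd h1.choose_spec (not_lt.2 hk)⟩

/-- Because the lists are prefixes of each other, the chosen index does not matter. -/
theorem get?_seqLimit {α : Type*} {l : ℕ → List α} (hl : ∀ i j, i ≤ j → l i <+: l j) {k : ℕ}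
    {a : α} : (seqLimit l).get? k = some a ↔ ∃ i, (l i)[k]? = some a := by
  classical
  change dite _ _ _ = _ ↔ _
  constructor
  · intro h
    split_ifs at h with h1
    exact ⟨_, h⟩
  · rintro ⟨i, hi⟩
    have hk : k < (l i).length := by
      by_contra h'
      rw [List.getElem?_eq_none (not_lt.1 h')] at hi
      simp at hi
    have hex : ∃ i, k < (l i).length := ⟨i, hk⟩
    rw [dif_pos hex]
    have hc := hex.choose_spec
    rcases le_total i hex.choose with h | h
    · obtain ⟨u, hu⟩ := hl _ _ h
      rw [← hu, List.getElem?_append_left hk, hi]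
    · obtain ⟨u, hu⟩ := hl _ _ h
      rw [← hu, List.getElem?_append_left hc] at hi
      exact hi

/-! ### Linearizations -/

namespace Hist

variable {P Q O R : Type*}

theorem get?_ofCalls_inv {S : Stream'.Seq (Call P O R)} {i : ℕ} {p : P} {o : O} :
    (ofCalls S).get? i = some (.inv p o) ↔
      ∃ k r, i = 2 * k ∧ S.get? k = some ⟨p, o, r⟩ := by
  change Option.map _ _ = _ ↔ _
  rw [Option.map_eq_some_iff]
  constructor
  · rintro ⟨⟨p', o', r⟩, hc, h⟩
    split_ifs at h with hi
    cases h
    exact ⟨i / 2, r, by omega, hc⟩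
  · rintro ⟨k, r, rfl, hc⟩
    exact ⟨⟨p, o, r⟩, by rwa [Nat.mul_div_cancel_left k two_pos], by simp⟩

theorem get?_ofCalls_res {S : Stream'.Seq (Call P O R)} {i : ℕ} {p : P} {o : O} {r : R} :
    (ofCalls S).get? i = some (.res p o r) ↔
      ∃ k, i = 2 * k + 1 ∧ S.get? k = some ⟨p, o, r⟩ := by
  change Option.map _ _ = _ ↔ _
  rw [Option.map_eq_some_iff]
  constructor
  · rintro ⟨⟨p', o', r⟩, hc, h⟩
    split_ifs at h with hi
    cases h
    exact ⟨i / 2, by omega, hc⟩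
  · rintro ⟨k, rfl, hc⟩
    exact ⟨⟨p, o, r⟩, by rwa [show (2 * k + 1) / 2 = k by omega], by simp⟩

theorem mem_iff_get? {α : Type*} {s : Stream'.Seq α} {a : α} : a ∈ s ↔ ∃ k, s.get? k = some a := by
  constructor
  · intro h
    obtain ⟨k, hk⟩ := h
    exact ⟨k, hk.symm⟩
  · rintro ⟨k, hk⟩
    exact ⟨k, hk.symm⟩

/-- A legal sequence of calls of invoked operations, which contains the complete operations and
respects the precedence relation, is a linearization. -/
theorem IsLinearization.of_calls {X : SeqObject Q O R} {H : Stream'.Seq (HEvent P O R)}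
    {S : Stream'.Seq (Call P O R)}
    (hinj : ∀ i j c c', S.get? i = some c → S.get? j = some c' → c.op = c'.op → i = j)
    (hinv : ∀ i c, S.get? i = some c → .inv c.proc c.op ∈ H)
    (hu : ∀ i j p p' o, H.get? i = some (.inv p o) → H.get? j = some (.inv p' o) → i = j)
    (hres : ∀ p o r, .res p o r ∈ H → ∃ i, S.get? i = some ⟨p, o, r⟩)
    (hprec : ∀ i j c c', S.get? i = some c → S.get? j = some c' → Precedes H c.op c'.op → i < j)
    (hlegal : Legal X S) : IsLinearization X H S := by
  have hinvS : ∀ o, HasInv (ofCalls S) o → ∃ k c, S.get? k = some c ∧ c.op = o := by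
    rintro o ⟨i, p, hi⟩
    obtain ⟨k, r, -, hk⟩ := get?_ofCalls_inv.1 hi
    exact ⟨k, _, hk, rfl⟩
  have hp : ∀ a b, HasInv (ofCalls S) a → HasInv (ofCalls S) b → Precedes H a b →
      Precedes (ofCalls S) a b := by
    intro a b ha hb hab
    obtain ⟨i, c, hi, rfl⟩ := hinvS a ha
    obtain ⟨j, c', hj, rfl⟩ := hinvS b hb
    have := hprec i j c c' hi hj hab
    exact ⟨2 * i + 1, 2 * j, c.proc, c'.proc, c.out, by omega, get?_ofCalls_res.2 ⟨i, rfl, hi⟩,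
      get?_ofCalls_inv.2 ⟨j, c'.out, rfl, hj⟩⟩
  -- The sequential history serves as its own completion, so equivalence is trivial.
  refine ⟨⟨ofCalls S, ⟨⟨?_, ?_, ?_⟩, ?_, ?_, ?_, hp⟩, fun _ => rfl⟩, hp, hlegal⟩
  · intro i j p p' o hi hj
    obtain ⟨k, r, rfl, hk⟩ := get?_ofCalls_inv.1 hi
    obtain ⟨k', r', rfl, hk'⟩ := get?_ofCalls_inv.1 hj
    rw [hinj k k' _ _ hk hk' rfl]
  · intro i j p p' o r r' hi hj
    obtain ⟨k, rfl, hk⟩ := get?_ofCalls_res.1 hi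
    obtain ⟨k', rfl, hk'⟩ := get?_ofCalls_res.1 hj
    rw [hinj k k' _ _ hk hk' rfl]
  · intro j p o r hj
    obtain ⟨k, rfl, hk⟩ := get?_ofCalls_res.1 hj
    exact ⟨2 * k, by omega, get?_ofCalls_inv.2 ⟨k, r, rfl, hk⟩⟩
  · rintro (⟨p, o⟩ | ⟨p, o, r⟩) he - ⟨j, p', r', hj⟩
    · obtain ⟨i, hi⟩ := hres p' o r' (mem_iff_get?.2 ⟨j, hj⟩)
      obtain ⟨k, hk⟩ := mem_iff_get?.1 (hinv i _ hi)
      obtain ⟨k', hk'⟩ := mem_iff_get?.1 he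
      have := hu k k' _ _ _ hk hk'
      subst this
      rw [hk] at hk'
      cases hk'
      exact mem_iff_get?.2 ⟨2 * i, get?_ofCalls_inv.2 ⟨i, r', rfl, hi⟩⟩
    · obtain ⟨i, hi⟩ := hres p o r he
      exact mem_iff_get?.2 ⟨2 * i + 1, get?_ofCalls_res.2 ⟨i, rfl, hi⟩⟩
  · intro p o h
    obtain ⟨i, hi⟩ := mem_iff_get?.1 h
    obtain ⟨k, r, -, hk⟩ := get?_ofCalls_inv.1 hi
    exact hinv k _ hk
  · intro p o h
    obtain ⟨i, hi⟩ := mem_iff_get?.1 h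
    obtain ⟨k, r, -, hk⟩ := get?_ofCalls_inv.1 hi
    exact ⟨r, mem_iff_get?.2 ⟨2 * k + 1, get?_ofCalls_res.2 ⟨k, rfl, hk⟩⟩⟩

/-- A growing sequence of orderings of operations yields a linearization, if the outputs are those
of the sequential object. -/
theorem IsLinearization.of_lists [DecidableEq O] {X : SeqObject Q O R}
    {H : Stream'.Seq (HEvent P O R)} {S : Stream'.Seq (Call P O R)} {w : ℕ → List O}
    {owner : O → P} {out : O → R} (hw : ∀ i j, i ≤ j → w i <+: w j) (hnd : ∀ i, (w i).Nodup)
    (hS : ∀ k c, S.get? k = some c ↔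
      ∃ i, ((w i).map fun o => Call.mk (owner o) o (out o))[k]? = some c)
    (hout : ∀ i, ∀ o ∈ w i, out o = X.result (w i) o)
    (hinv : ∀ i, ∀ o ∈ w i, .inv (owner o) o ∈ H)
    (hu : ∀ i j p p' o, H.get? i = some (.inv p o) → H.get? j = some (.inv p' o) → i = j)
    (hres : ∀ p o r, .res p o r ∈ H → (∃ i, o ∈ w i) ∧ p = owner o ∧ r = out o)
    (hirr : ∀ i, ∀ o ∈ w i, ¬ Precedes H o o)
    (hprec : ∀ i, (w i).Pairwise fun a b => ¬ Precedes H b a) : IsLinearization X H S := by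
  have hget : ∀ k c, S.get? k = some c ↔ ∃ i, (w i)[k]? = some c.op ∧ c.proc = owner c.op ∧
      c.out = out c.op := by
    intro k c
    rw [hS]
    refine exists_congr fun i => ?_
    rw [List.getElem?_map, Option.map_eq_some_iff]
    constructor
    · rintro ⟨o, ho, rfl⟩
      exact ⟨ho, rfl, rfl⟩
    · rintro ⟨h1, h2, h3⟩
      refine ⟨_, h1, ?_⟩
      rw [← h2, ← h3]
  have hlift : ∀ (i j k : ℕ) (o : O), i ≤ j → (w i)[k]? = some o → (w j)[k]? = some o := by
    intro i j k o hij ho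
    obtain ⟨u, hu⟩ := hw i j hij
    obtain ⟨hk, -⟩ := List.getElem?_eq_some_iff.1 ho
    rw [← hu, List.getElem?_append_left hk, ho]
  have htwo : ∀ i j c c', S.get? i = some c → S.get? j = some c' →
      ∃ m, (w m)[i]? = some c.op ∧ (w m)[j]? = some c'.op := by
    intro i j c c' hi hj
    obtain ⟨a, ha, -⟩ := (hget i c).1 hi
    obtain ⟨b, hb, -⟩ := (hget j c').1 hj
    exact ⟨max a b, hlift _ _ _ _ (le_max_left _ _) ha, hlift _ _ _ _ (le_max_right _ _) hb⟩
  refine .of_calls ?_ ?_ hu ?_ ?_ ?_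
  · intro i j c c' hi hj hcc
    obtain ⟨m, h1, h2⟩ := htwo i j c c' hi hj
    obtain ⟨hi', h1⟩ := List.getElem?_eq_some_iff.1 h1
    obtain ⟨hj', h2⟩ := List.getElem?_eq_some_iff.1 h2
    exact ((hnd m).getElem_inj_iff).1 (by rw [h1, h2, hcc])
  · intro k c hk
    obtain ⟨i, h1, h2, -⟩ := (hget k c).1 hk
    rw [h2]
    exact hinv i _ (List.mem_of_getElem? h1)
  · intro p o r h
    obtain ⟨⟨i, hi⟩, rfl, rfl⟩ := hres p o r h
    obtain ⟨k, hk⟩ := List.mem_iff_getElem?.1 hi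
    exact ⟨k, (hget k _).2 ⟨i, hk, rfl, rfl⟩⟩
  · intro i j c c' hi hj hp
    obtain ⟨m, h1, h2⟩ := htwo i j c c' hi hj
    obtain ⟨hi', h1⟩ := List.getElem?_eq_some_iff.1 h1
    obtain ⟨hj', h2⟩ := List.getElem?_eq_some_iff.1 h2
    by_contra hlt
    rcases (not_lt.1 hlt).eq_or_lt with rfl | hji
    · rw [← h1, ← h2] at hp
      exact hirr m _ (List.getElem_mem hi') hp
    · refine List.pairwise_iff_getElem.1 (hprec m) j i hj' hi' hji ?_
      rwa [h1, h2]
  · intro k c hk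
    obtain ⟨i, h1, -, h3⟩ := (hget k c).1 hk
    -- Legality speaks of `S`, which may be infinite, but its first `k` calls already lie in the
    -- finite list `w i`.
    have htake : (S.take k).map Call.op = (w i).take k := by
      apply List.ext_getElem?
      intro j
      rw [List.getElem?_map, Stream'.Seq.getElem?_take, List.getElem?_take]
      split_ifs with hjk
      · obtain ⟨hk', -⟩ := List.getElem?_eq_some_iff.1 h1
        have hj : (w i)[j]? = some (w i)[j] := List.getElem?_eq_getElem (by omega)
        rw [hj, (hget j ⟨owner (w i)[j], (w i)[j], out (w i)[j]⟩).2 ⟨i, hj, rfl, rfl⟩]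
        rfl
      · rfl
    obtain ⟨hk', h1⟩ := List.getElem?_eq_some_iff.1 h1
    rw [htake, h3, hout i _ (h1 ▸ List.getElem_mem hk')]
    have hsplit : w i = (w i).take k ++ c.op :: (w i).drop (k + 1) := by
      rw [← h1, ← List.drop_eq_getElem_cons hk', List.take_append_drop]
    have hnot : c.op ∉ (w i).take k := by
      have := hnd i
      rw [hsplit, List.nodup_append] at this
      exact fun h => this.2.2 _ h _ (by simp) rfl
    conv_lhs => rw [hsplit]
    exact X.result_append_cons_self hnot _

end Hist

/-! ### Histories of runs and the system state at the second read -/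

namespace UC

open Hist

theorem bind_toHist_inv {P O R A : Type*} {x : Option (Event P O R A)} {p : P} {o : O} :
    x.bind Event.toHist = some (.inv p o) ↔ x = some (.inv p o) := by
  rcases x with _ | (_ | _ | _) <;> simp [Event.toHist]

theorem bind_toHist_res {P O R A : Type*} {x : Option (Event P O R A)} {p : P} {o : O} {r : R} :
    x.bind Event.toHist = some (.res p o r) ↔ x = some (.res p o r) := by
  rcases x with _ | (_ | _ | _) <;> simp [Event.toHist]

variable {n : ℕ} {Q O R : Type*} [DecidableEq O] {X : SeqObject Q O R}
  {lin : DepGraph O → List O} {sel : Fin n → O → ℕ → ABC O → O}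

open Classical in
/-- The number of events of the history among the first `i` events of a run. -/
noncomputable def histCount (ρ : (impl n X lin sel).Run) (i : ℕ) : ℕ :=
  Nat.count (fun j => ((ρ.events.get? j).bind Event.toHist).isSome) i

theorem get?_history {ρ : (impl n X lin sel).Run} {k : ℕ} {e : HEvent (Fin n) O R} :
    ρ.history.get? k = some e ↔
      ∃ i, (ρ.events.get? i).bind Event.toHist = some e ∧ histCount ρ i = k :=
  get?_seqFilterMap _ _ _ _

theorem lt_of_histCount_lt {ρ : (impl n X lin sel).Run} {i j : ℕ}
    (h : histCount ρ i < histCount ρ j) : i < j := by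
  classical
  by_contra h'
  exact absurd (Nat.count_monotone _ (not_lt.1 h')) (not_le.2 h)

theorem histCount_lt {ρ : (impl n X lin sel).Run} {i j : ℕ} {e : HEvent (Fin n) O R}
    (hi : (ρ.events.get? i).bind Event.toHist = some e) (h : i < j) :
    histCount ρ i < histCount ρ j := by
  classical
  exact Nat.count_strict_mono (by simp [hi]) h

/-- `H` is the history of those events of the run whose index satisfies `N`. -/
def HistoryOn (ρ : (impl n X lin sel).Run) (N : ℕ → Prop) (H : Stream'.Seq (HEvent (Fin n) O R)) :
    Prop :=
  ∀ k e, H.get? k = some e ↔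
    ∃ i, N i ∧ (ρ.events.get? i).bind Event.toHist = some e ∧ histCount ρ i = k

theorem historyOn_history (ρ : (impl n X lin sel).Run) :
    HistoryOn ρ (fun _ => True) ρ.history := fun k e => by
  simp [get?_history]

theorem historyOn_seqTake (ρ : (impl n X lin sel).Run) (t : ℕ) :
    HistoryOn ρ (fun i => i < t) (seqTake (histCount ρ t) ρ.history) := fun k e => by
  rw [get?_seqTake, get?_history]
  constructor
  · rintro ⟨hk, i, hi, rfl⟩
    exact ⟨i, lt_of_histCount_lt hk, hi, rfl⟩
  · rintro ⟨i, hit, hi, rfl⟩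
    exact ⟨histCount_lt hi hit, i, hi, rfl⟩

namespace HistoryOn

variable {ρ : (impl n X lin sel).Run} {N : ℕ → Prop} {H : Stream'.Seq (HEvent (Fin n) O R)}

theorem inv_mem_iff (h : HistoryOn ρ N H) {p : Fin n} {o : O} :
    .inv p o ∈ H ↔ ∃ i, N i ∧ ρ.events.get? i = some (.inv p o) := by
  rw [mem_iff_get?]
  constructor
  · rintro ⟨k, hk⟩
    obtain ⟨i, hN, hi, -⟩ := (h k _).1 hk
    exact ⟨i, hN, bind_toHist_inv.1 hi⟩
  · rintro ⟨i, hN, hi⟩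
    exact ⟨_, (h _ _).2 ⟨i, hN, bind_toHist_inv.2 hi, rfl⟩⟩

theorem res_mem_iff (h : HistoryOn ρ N H) {p : Fin n} {o : O} {r : R} :
    .res p o r ∈ H ↔ ∃ i, N i ∧ ρ.events.get? i = some (.res p o r) := by
  rw [mem_iff_get?]
  constructor
  · rintro ⟨k, hk⟩
    obtain ⟨i, hN, hi, -⟩ := (h k _).1 hk
    exact ⟨i, hN, bind_toHist_res.1 hi⟩
  · rintro ⟨i, hN, hi⟩
    exact ⟨_, (h _ _).2 ⟨i, hN, bind_toHist_res.2 hi, rfl⟩⟩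

theorem hasInv_iff (h : HistoryOn ρ N H) {o : O} :
    HasInv H o ↔ ∃ i p, N i ∧ ρ.events.get? i = some (.inv p o) := by
  constructor
  · rintro ⟨k, p, hk⟩
    obtain ⟨i, hi⟩ := h.inv_mem_iff.1 (mem_iff_get?.2 ⟨k, hk⟩)
    exact ⟨i, p, hi⟩
  · rintro ⟨i, p, hi⟩
    obtain ⟨k, hk⟩ := mem_iff_get?.1 (h.inv_mem_iff.2 ⟨i, hi⟩)
    exact ⟨k, p, hk⟩

theorem inv_unique (h : HistoryOn ρ N H) (i j : ℕ) (p p' : Fin n) (o : O)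
    (hi : H.get? i = some (.inv p o)) (hj : H.get? j = some (.inv p' o)) : i = j := by
  obtain ⟨k, -, hk, rfl⟩ := (h _ _).1 hi
  obtain ⟨k', -, hk', rfl⟩ := (h _ _).1 hj
  rw [ρ.inv_unique k k' p p' o (bind_toHist_inv.1 hk) (bind_toHist_inv.1 hk')]

theorem exists_of_precedes (h : HistoryOn ρ N H) {a b : O} (hab : Precedes H a b) :
    ∃ i j p p' r, i < j ∧ ρ.events.get? i = some (.res p a r) ∧
      ρ.events.get? j = some (.inv p' b) := by
  obtain ⟨i, j, p, p', r, hij, hi, hj⟩ := hab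
  obtain ⟨k, -, hk, rfl⟩ := (h _ _).1 hi
  obtain ⟨k', -, hk', rfl⟩ := (h _ _).1 hj
  exact ⟨k, k', p, p', r, lt_of_histCount_lt hij, bind_toHist_res.1 hk, bind_toHist_inv.1 hk'⟩

end HistoryOn

namespace Trace

/-- The time is that of the response of `a`: responses come after the commit, and `b`, not yet
invoked, cannot be announced. -/
theorem exists_of_precedes (hlin : Sorts lin) (hsel : SelectsMin sel)
    {ρ : (impl n X lin sel).Run} {N : ℕ → Prop} {H : Stream'.Seq (HEvent (Fin n) O R)}
    (h : HistoryOn ρ N H) {a b : O} (hab : Precedes H a b) :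
    ∃ i, a ∈ (ofRun ρ).V i ∧ b ∉ (ofRun ρ).A i := by
  obtain ⟨i, j, p, p', r, hij, hi, hj⟩ := h.exists_of_precedes hab
  refine ⟨i, (res_eq_result (τ := ofRun ρ) hlin hsel hi).2.1, fun hb => ?_⟩
  obtain ⟨k, hk, q, hk'⟩ := exists_inv_of_mem_A hsel hb
  have := ρ.inv_unique k j q p' b hk' hj
  omega

open Classical in
/-- The process that executes `o`. -/
noncomputable def proc (τ : Trace n X lin sel) (p : Fin n) (o : O) : Fin n :=
  if h : ∃ q i, τ.ev i = some (.inv q o) then h.choose else p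

theorem proc_eq {τ : Trace n X lin sel} {p q : Fin n} {o : O} {i : ℕ}
    (h : τ.ev i = some (.inv q o)) : τ.proc p o = q := by
  have hex : ∃ q i, τ.ev i = some (.inv q o) := ⟨q, i, h⟩
  rw [proc, dif_pos hex]
  obtain ⟨j, hj⟩ := hex.choose_spec
  exact (inv_unique' hj h).2

/-- The output of `o` in the order of commits. -/
noncomputable def out (τ : Trace n X lin sel) (o : O) : R := X.result (τ.commits (τ.com o)) o

theorem out_eq {τ : Trace n X lin sel} {i : ℕ} {o : O} (h : o ∈ τ.V i) :
    τ.out o = X.result (τ.commits i) o :=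
  (result_commits_mono ((com_le_iff h).2 h) ((com_le_iff h).1 le_rfl)).symm

theorem not_precedes_self (hlin : Sorts lin) (hsel : SelectsMin sel)
    {ρ : (impl n X lin sel).Run} {N : ℕ → Prop} {H : Stream'.Seq (HEvent (Fin n) O R)}
    (h : HistoryOn ρ N H) (o : O) : ¬ Precedes H o o := fun hp => by
  obtain ⟨i, h1, h2⟩ := exists_of_precedes hlin hsel h hp
  exact h2 (V_subset_A hsel i h1)

theorem pairwise_lin (hlin : Sorts lin) (hsel : SelectsMin sel)
    {ρ : (impl n X lin sel).Run} {N : ℕ → Prop} {H : Stream'.Seq (HEvent (Fin n) O R)}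
    (h : HistoryOn ρ N H) (t : ℕ) :
    (lin ((ofRun ρ).val t).C).Pairwise fun a b => ¬ Precedes H b a := by
  have hg := good_lin hlin hsel (ofRun ρ) t
  refine hg.pairwise.imp_of_mem fun {a b} ha _ hr hp => hr ?_
  obtain ⟨i, h1, h2⟩ := exists_of_precedes hlin hsel h hp
  exact req_of_lt hsel h1 ((mem_lin hlin hsel).1 ha) h2

/-- The prefix of the history is cut at the second read, and the linearization is the list read
there followed by all later commits. Outputs are those of the commit order, which `lin_equiv`
transfers. -/
theorem isSystemState (hlin : Sorts lin) (hsel : SelectsMin sel) {ρ : (impl n X lin sel).Run}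
    {p : Fin n} {op : O} {t : ℕ} (hread : (ofRun ρ).SecondReadAt p op t) :
    IsSystemState X ρ.history op (lin ((ofRun ρ).val t).C)
      {o | HasInv (seqTake (histCount ρ t) ρ.history) o ∧ o ∉ lin ((ofRun ρ).val t).C ∧
        o ≠ op} := by
  set τ := ofRun ρ with hτ
  have hH := historyOn_history ρ
  have hH' := historyOn_seqTake ρ t
  set l := lin (τ.val t).C with hl
  choose u hu huV using fun i => τ.commits_prefix (Nat.le_add_right t i)
  have hequiv : ∀ i, X.OrdEquiv (l ++ u i) (τ.commits (t + i)) := fun i => by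
    rw [hu i]
    exact (lin_equiv hlin hsel τ t).append_right _
  have hnd : ∀ i, (l ++ u i).Nodup := fun i =>
    (hequiv i).1.nodup_iff.2 (commits_nodup hsel _)
  have hmem : ∀ i o, o ∈ l ++ u i ↔ o ∈ τ.V (t + i) := fun i o =>
    (hequiv i).1.mem_iff.trans mem_commits
  have hpre : ∀ i j, i ≤ j → l ++ u i <+: l ++ u j := fun i j hij => by
    obtain ⟨v, hv, -⟩ := τ.commits_prefix (show t + i ≤ t + j by omega)
    rw [hu i, hu j, List.append_assoc] at hv
    rw [List.append_cancel_left hv, ← List.append_assoc]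
    exact List.prefix_append _ _
  set call : O → Call (Fin n) O R := fun o => ⟨τ.proc p o, o, τ.out o⟩ with hcall
  have hpre' : ∀ i j, i ≤ j → (l ++ u i).map call <+: (l ++ u j).map call := fun i j hij =>
    (hpre i j hij).map _
  have hres : ∀ (q : Fin n) (o : O) (r : R) (i : ℕ), ρ.events.get? i = some (.res q o r) →
      o ∈ τ.V i ∧ q = τ.proc p o ∧ r = τ.out o := fun q o r i hi => by
    obtain ⟨h1, h2, h3⟩ := res_eq_result (τ := τ) hlin hsel hi
    obtain ⟨j, -, hj⟩ := exists_inv_of_cur h1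
    exact ⟨h2, (proc_eq hj).symm, by rw [out_eq h2, h3]⟩
  have hinvt : ∀ i, ∀ o ∈ τ.V i, ∃ j < i, ρ.events.get? j = some (.inv (τ.proc p o) o) :=
    fun i o ho => by
      obtain ⟨j, hj, q, hq⟩ := exists_inv_of_mem_A hsel (V_subset_A hsel i ho)
      refine ⟨j, hj, ?_⟩
      rw [proc_eq hq]
      exact hq
  refine ⟨seqTake (histCount ρ t) ρ.history, fun i a h => (get?_seqTake.1 h).2, ?_, ?_,
    ⟨seqLimit fun i => (l ++ u i).map call, ?_, l.map call, ?_, ?_, ?_, ?_⟩, rfl⟩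
  · obtain ⟨j, hj, hj'⟩ := exists_inv_of_cur (hread.ev_cur hsel)
    exact hH'.hasInv_iff.2 ⟨j, p, hj, hj'⟩
  · rintro ⟨k, q, r, hk⟩
    obtain ⟨i, hi, hi'⟩ := hH'.res_mem_iff.1 (mem_iff_get?.2 ⟨k, hk⟩)
    -- A response before the read would mean that `op` was already committed there.
    exact hread.2.2 (V_mono hi.le (hres q op r i hi').1)
  · refine .of_lists (w := fun i => l ++ u i) (owner := τ.proc p) (out := τ.out) hpre hnd
      (fun k c => get?_seqLimit hpre') ?_ ?_ hH.inv_unique ?_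
      (fun _ o _ => not_precedes_self hlin hsel hH o) ?_
    · intro i o ho
      rw [out_eq ((hmem i o).1 ho), (hequiv i).2.2 o ho]
    · intro i o ho
      obtain ⟨j, -, hj⟩ := hinvt _ o ((hmem i o).1 ho)
      exact hH.inv_mem_iff.2 ⟨j, trivial, hj⟩
    · intro q o r h
      obtain ⟨i, -, hi⟩ := hH.res_mem_iff.1 h
      obtain ⟨h1, h2⟩ := hres q o r i hi
      exact ⟨⟨i, (hmem i o).2 (V_mono (by omega) h1)⟩, h2⟩
    · intro i
      -- Commit order respects precedence; this covers the later commits and their position after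
      -- `l`, while inside `l` the edges of the graph are needed.
      have key : ∀ a ∈ τ.V (t + i), ∀ b, τ.com a < τ.com b → ¬ Precedes ρ.history b a := by
        intro a ha b hab hp
        obtain ⟨j, h1, h2⟩ := exists_of_precedes hlin hsel hH hp
        have h3 : τ.com b ≤ j := (com_le_iff h1).2 h1
        exact h2 (V_subset_A hsel j ((com_le_iff ha).1 (by omega)))
      have hsort := commits_sorted (τ := τ) hsel (t + i)
      rw [hu i, List.pairwise_append] at hsort
      refine List.pairwise_append.2 ⟨pairwise_lin hlin hsel hH t, ?_, ?_⟩
      · exact hsort.2.1.imp_of_mem fun {a b} ha _ hab =>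
          key a ((hmem i a).1 (by simp [ha])) b hab
      · intro a ha b hb
        exact key a ((hmem i a).1 (by simp [ha])) b
          (hsort.2.2 a (mem_commits.2 ((mem_lin hlin hsel).1 ha)) b hb)
  · rw [List.map_map]
    exact List.map_id _
  · intro k c hk
    rw [Stream'.Seq.ofList_get?] at hk
    refine (get?_seqLimit hpre').2 ⟨0, ?_⟩
    obtain ⟨hk', -⟩ := List.getElem?_eq_some_iff.1 hk
    rw [List.map_append, List.getElem?_append_left hk', hk]
  · refine .of_lists (w := fun _ => l) (owner := τ.proc p) (out := τ.out)
      (fun _ _ _ => List.prefix_rfl) (fun _ => (hnd 0).of_append_left)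
      (fun k c => by rw [Stream'.Seq.ofList_get?]; simp [hcall]) ?_ ?_ hH'.inv_unique ?_
      (fun _ o _ => not_precedes_self hlin hsel hH' o) (fun _ => pairwise_lin hlin hsel hH' t)
    · intro _ o ho
      rw [out_eq ((mem_lin hlin hsel).1 ho), (lin_equiv hlin hsel τ t).2.2 o ho]
    · intro _ o ho
      obtain ⟨j, h1, hj⟩ := hinvt _ o ((mem_lin hlin hsel).1 ho)
      exact hH'.inv_mem_iff.2 ⟨j, h1, hj⟩
    · intro q o r h
      obtain ⟨i, hit, hi⟩ := hH'.res_mem_iff.1 h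
      obtain ⟨h1, h2⟩ := hres q o r i hi
      exact ⟨⟨0, (mem_lin hlin hsel).2 (V_mono hit.le h1)⟩, h2⟩
  · exact fun h => hread.2.2 ((mem_lin hlin hsel).1 h)

/-- A process that uses consensus has found a conflict at its second read. -/
theorem slowRead_of_usesStrong (hsel : SelectsMin sel) {ρ : (impl n X lin sel).Run} {p : Fin n}
    {op : O} (h : ρ.UsesStrong p op) : ∃ i, (ofRun ρ).SlowRead i p op := by
  obtain ⟨i, a, hi, ha⟩ := h
  refine ⟨i, ?_⟩
  set τ := ofRun ρ
  change Access.IsStrong a at ha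
  have hev : τ.ev i = some (.step p op a) := hi
  rcases τ.step i with ⟨h, -⟩ | ⟨q, o, h, -⟩ | ⟨q, o, b, L, h, hc, hmv, -⟩ | ⟨q, o, r, h, -⟩
  · simp [hev] at h
  · simp [hev] at h
  · rw [hev] at h
    cases h
    have key : ∀ o k w, (τ.loc i p).pc = .propose o k w → τ.SlowRead i p op := by
      intro o k w hpc
      obtain ⟨h1, h2, -⟩ := τ.pcInv hsel hpc
      rw [hc, Option.some.injEq] at h1
      exact h1 ▸ h2
    generalize τ.loc i p = K at hmv key
    generalize τ.mem (i + 1) = m' at hmv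
    cases hmv <;> first
      | exact absurd ha id
      | exact key _ _ _ rfl
  · simp [hev] at h

end Trace

end UC

/-! ### The main theorem -/

theorem mainTheorem2 {Q O R : Type*} [DecidableEq O] (n : ℕ) (X : SeqObject Q O R)
    (lin : DepGraph O → List O)
    (hlin : ∀ C : DepGraph O, C.Acyclic → C.IsTopologicalOrdering (lin C))
    (sel : Fin n → O → ℕ → ABC O → O)
    (hsel : ∀ (p : Fin n) (op : O) (k : ℕ) (v : ABC O),
      (∃ w, v.IsMinBooked w) → v.IsMinBooked (sel p op k v)) :
    Implementation.DynamicallyConcurrent X (UC.impl n X lin sel) ∧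
    ∀ (ρ : (UC.impl n X lin sel).Run) (p : Fin n) (op : O),
      .inv p op ∈ ρ.history → ρ.UsesStrong p op →
      ∃ v : ABC O, UC.SecondRead ρ p op v ∧
        ∃ Os : Set O, Hist.IsSystemState X ρ.history op (lin v.C) Os ∧
          (((v.A \ v.C.vertices) \ {op} : Finset O) : Set O) ⊆ Os ∧
          ∃ O' ⊆ (v.A \ v.C.vertices) \ {op}, ¬ X.CommutesSet op (lin v.C) (O' : Set O) := by
  -- The precise statement about the second read implies dynamic concurrency, so only the former
  -- needs the protocol.
  refine and_iff_right_of_imp ?_ |>.2 ?_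
  · intro h ρ p op hinv hstrong
    obtain ⟨v, -, Os, hs, hsub, O', hO', hc⟩ := h ρ p op hinv hstrong
    exact ⟨lin v.C, Os, hs, O', (Finset.coe_subset.2 hO').trans hsub, hc⟩
  · intro ρ p op _ hstrong
    obtain ⟨i, t, -, hread, hc⟩ := UC.Trace.slowRead_of_usesStrong hsel hstrong
    refine ⟨(UC.Trace.ofRun ρ).val t, ?_, _, UC.Trace.isSystemState hlin hsel hread, ?_, ?_⟩
    · have hev : ρ.events.get? t = some (.step p op (.snapshotS : UC.Access O)) := hread.1
      have hconf := UC.Trace.runConfig_eq ρ (i := t) (by rw [hev]; rfl)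
      refine ⟨t, _, _, hev, rfl, rfl, ?_, ?_⟩
      · rw [← hconf]
        exact hread.2.1
      · rw [← hconf]
        rfl
    · intro o ho
      simp only [Finset.coe_sdiff, Set.mem_sdiff, Finset.mem_coe, Finset.coe_singleton,
        Set.mem_singleton_iff] at ho
      obtain ⟨⟨hA, hV⟩, hne⟩ := ho
      obtain ⟨j, hj, q, hq⟩ := UC.Trace.exists_inv_of_mem_A hsel hA
      exact ⟨(UC.historyOn_seqTake ρ t).hasInv_iff.2 ⟨j, q, hj, hq⟩,
        fun h => hV ((UC.Trace.mem_lin hlin hsel).1 h), hne⟩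
    · unfold UC.Trace.CommutesAt at hc
      push Not at hc
      exact hc
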